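/- **Setting.** Let $\mathbf{DL}$ be the category of bounded distributive lattices, with hom-sets ordered pointwise, and let $P:\mathbf{Set}^{op}\to\mathbf{DL}$ be the contravariant powerset functor. Let $V$ be a set of parametric variables, $x\notin V$ a fixpoint variable, and $\Lambda$ a set of modalities $\heartsuit$ of finite arity. Let $B:\mathbf{Set}\to\mathbf{Set}$ be a functor, and for each $\heartsuit\in\Lambda$ of arity $n$ let $[\heartsuit]:P^n\to PB$ be a monotone predicate lifting (natural, and monotone at every set). Let $\sigma:X\to BX$ be a coalgebra. **Syntax.** Fixpoint schemes $\gamma$ and formulas $\phi$ are given by $$\gamma::= v\in V\mid x\mid\phi\mid\gamma\vee\gamma\mid\gamma\wedge\gamma\mid\heartsuit(\bar\gamma)\mid\sharp_\gamma(\bar\gamma/\bar v),\qquad \phi::=\top\mid\bot\mid\phi\vee\phi\mid\phi\wedge\phi\mid\heartsuit(\bar\phi)\mid\sharp_\gamma(\bar\phi/\bar v),$$ where in $\sharp_\gamma(- /\bar v)$ the finite set $\bar v$ contains the parametric variables of $\gamma$. Guarded schemes are given by $\gamma_g::=v\mid\gamma_g\vee\gamma_g\mid\gamma_g\wedge\gamma_g\mid\heartsuit(\bar\gamma)$.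 In what follows we use only those schemes and formulas in which every $\sharp_\gamma$ that occurs, at any depth, has $\gamma$ guarded. **Set-theoretic semantics.** For $p$ a valuation of the parametric variables in $PX$ and $\xi\subseteq X$, put $[\![v]\!]_p^\xi=p(v)$, $[\![x]\!]_p^\xi=\xi$, $[\![\phi]\!]_p^\xi=[\![\phi]\!]$, interpret $\top,\bot,\vee,\wedge$ as $X,\varnothing,\cup,\cap$, put $[\![\heartsuit(\bar\gamma)]\!]_p^\xi=\sigma^{-1}([\heartsuit]([\![\bar\gamma]\!]_p^\xi))$, and let $[\![\sharp_\gamma(\bar\delta/\bar v)]\!]_p^\xi$ be the least fixpoint of $U\mapsto[\![\gamma]\!]^U_{[\![\bar\delta]\!]_p^\xi/\bar v}$; likewise for formulas, without $p$ and $\xi$. **Unfolding system.** Let $L_0A$ be the free bounded distributive lattice on the symbols $\heartsuit(a_1,\dots,a_n)$, $a_i\in A$, and $LA$ the one on the symbols $\sharp_\gamma(\bar a/\bar v)$ with $\gamma$ guarded, each modulo the least congruence that makes all of these operators monotone. Let $\delta:L_0P\to PB$ be given by $\heartsuit(\bar U)\mapsto[\heartsuit](\bar U)$. Let $T$ be the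 algebraically free monad on $L_0+L$ (so $TA$ is the free $(L_0+L)$-algebra over $A$, with unit $\eta$). Unfolding $\sharp_\gamma(\bar a/\bar v)\mapsto\gamma(\bar a/\bar v,\sharp_\gamma(\bar a/\bar v)/x)$ gives, by guardedness, a natural transformation $\mathsf{unf}:L\to\mathrm{id}+L_0T$. Put $\theta_A=[\eta,\mathrm{str}]:A+L_0TA\to TA$. Let $\mathsf{unf}^*_A:TA\to A+L_0TA$ be the morphism of $(L_0+L)$-algebras that extends $\mathrm{inl}:A\to A+L_0TA$, where $A+L_0TA$ carries the $L_0$-structure $\mathrm{inr}\circ L_0\theta_A$ and the $L$-structure $$L(A+L_0TA)\xrightarrow{\mathsf{unf}}(A+L_0TA)+L_0T(A+L_0TA)\xrightarrow{[\mathrm{id},\ \mathrm{inr}\circ L_0(\mathrm{mult}\circ T\theta_A)]}A+L_0TA.$$ Then $(\mathsf{unf}^*:T\to\mathrm{id}+L_0T,\ \delta)$ is an unfolding system. Let $\alpha:T\Phi\to\Phi$ be an initial algebra of the functor $T$. The semantic map $s:\Phi\to PX$ is the least (pointwise) morphism $t$ of $\mathbf{DL}$ with $$t=[\mathrm{id}_{PX},P\sigma]\circ(\mathrm{id}+\delta_X)\circ(t+L_0t)\circ(\mathrm{id}+L_0\alpha)\circ\mathsf{unf}^*_\Phi\circ\alpha^{-1}.$$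 A formula $\phi$ is a closed $(L_0+L)$-term, so it has a class $[\phi]_A\in TA$ for every $A$. Let $\mathrm{fl}:\Phi\to T0$ be the unique morphism of $T$-algebras into $T0$ with the monad multiplication ($0$ the initial bounded distributive lattice). Say that $\phi$ represents $a\in\Phi$ if $\mathrm{fl}(a)=[\phi]_0$. **Proposition.** The semantic map $s$ exists, and it agrees with the set-theoretic semantics: $s(\alpha([\phi]_\Phi))=[\![\phi]\!]$ for every formula $\phi$; moreover every $a\in\Phi$ is represented by some formula, and $s(a)=[\![\phi]\!]$ for every formula $\phi$ that represents $a$. -/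

import Mathlib

open CategoryTheory CategoryTheory.Limits Opposite

universe u

namespace CFL

/-! ### Bounded distributive lattices with monotone operators, by generators and relations -/

/-- Terms over generators `G` in the signature of bounded lattices extended by operators `o : O`
of arity `ar o`. -/
inductive Tm (G : Type u) {O : Type} (ar : O → Type) : Type u
  | gen (g : G) : Tm G ar
  | top : Tm G ar
  | bot : Tm G ar
  | sup (s t : Tm G ar) : Tm G ar
  | inf (s t : Tm G ar) : Tm G ar
  | op (o : O) (ts : ar o → Tm G ar) : Tm G ar

/-- The least preorder on terms that contains `R`, makes the lattice connectives into bounded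
distributive lattice operations, and makes all the operators monotone. -/
inductive Tm.Le {G : Type u} {O : Type} {ar : O → Type} (R : Tm G ar → Tm G ar → Prop) :
    Tm G ar → Tm G ar → Prop
  | rel {s t} : R s t → Tm.Le R s t
  | refl (s) : Tm.Le R s s
  | trans {s t r} : Tm.Le R s t → Tm.Le R t r → Tm.Le R s r
  | le_top (s) : Tm.Le R s .top
  | bot_le (s) : Tm.Le R .bot s
  | le_sup_left (s t) : Tm.Le R s (.sup s t)
  | le_sup_right (s t) : Tm.Le R t (.sup s t)
  | sup_le {s t r} : Tm.Le R s r → Tm.Le R t r → Tm.Le R (.sup s t) r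
  | inf_le_left (s t) : Tm.Le R (.inf s t) s
  | inf_le_right (s t) : Tm.Le R (.inf s t) t
  | le_inf {s t r} : Tm.Le R r s → Tm.Le R r t → Tm.Le R r (.inf s t)
  | distrib (s t r) : Tm.Le R (.inf (.sup s t) (.sup s r)) (.sup s (.inf t r))
  | op_mono (o : O) {ss ts : ar o → Tm G ar} :
      (∀ i, Tm.Le R (ss i) (ts i)) → Tm.Le R (.op o ss) (.op o ts)

section Presentation

variable {G : Type u} {O : Type} {ar : O → Type} (R : Tm G ar → Tm G ar → Prop)

/-- The congruence generated by `R`: mutual inequality. -/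
def Tm.setoid : Setoid (Tm G ar) where
  r s t := Tm.Le R s t ∧ Tm.Le R t s
  iseqv := ⟨fun s => ⟨.refl s, .refl s⟩, fun h => ⟨h.2, h.1⟩,
    fun h k => ⟨h.1.trans k.1, k.2.trans h.2⟩⟩

/-- The carrier of the presented algebra. -/
def PresCarrier : Type u := Quotient (Tm.setoid R)

def PresCarrier.mk (t : Tm G ar) : PresCarrier R := Quotient.mk (Tm.setoid R) t

instance : LE (PresCarrier R) where
  le := Quotient.lift₂ (s₁ := Tm.setoid R) (s₂ := Tm.setoid R) (fun s t => Tm.Le R s t)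
    (fun _ _ _ _ h k => propext
      ⟨fun l => h.2.trans (l.trans k.1), fun l => h.1.trans (l.trans k.2)⟩)

variable {R} in
theorem PresCarrier.mk_le {s t : Tm G ar} :
    PresCarrier.mk R s ≤ PresCarrier.mk R t ↔ Tm.Le R s t := Iff.rfl

variable {R} in
theorem PresCarrier.ind {p : PresCarrier R → Prop} (h : ∀ t, p (PresCarrier.mk R t)) (q) : p q :=
  Quotient.ind (s := Tm.setoid R) h q

instance : DistribLattice (PresCarrier R) where
  le_refl := PresCarrier.ind fun s => Tm.Le.refl s
  le_trans := PresCarrier.ind fun _ => PresCarrier.ind fun _ => PresCarrier.ind fun _ =>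
    Tm.Le.trans
  le_antisymm := PresCarrier.ind fun _ => PresCarrier.ind fun _ => fun h k =>
    Quotient.sound (s := Tm.setoid R) ⟨h, k⟩
  sup := Quotient.map₂ (sa := Tm.setoid R) (sb := Tm.setoid R) (sc := Tm.setoid R) Tm.sup
    (fun _ _ h _ _ k =>
      ⟨.sup_le (h.1.trans (.le_sup_left _ _)) (k.1.trans (.le_sup_right _ _)),
        .sup_le (h.2.trans (.le_sup_left _ _)) (k.2.trans (.le_sup_right _ _))⟩)
  inf := Quotient.map₂ (sa := Tm.setoid R) (sb := Tm.setoid R) (sc := Tm.setoid R) Tm.inf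
    (fun _ _ h _ _ k =>
      ⟨.le_inf ((Tm.Le.inf_le_left _ _).trans h.1) ((Tm.Le.inf_le_right _ _).trans k.1),
        .le_inf ((Tm.Le.inf_le_left _ _).trans h.2) ((Tm.Le.inf_le_right _ _).trans k.2)⟩)
  le_sup_left := PresCarrier.ind fun _ => PresCarrier.ind fun _ => Tm.Le.le_sup_left _ _
  le_sup_right := PresCarrier.ind fun _ => PresCarrier.ind fun _ => Tm.Le.le_sup_right _ _
  sup_le := PresCarrier.ind fun _ => PresCarrier.ind fun _ => PresCarrier.ind fun _ => Tm.Le.sup_le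
  inf_le_left := PresCarrier.ind fun _ => PresCarrier.ind fun _ => Tm.Le.inf_le_left _ _
  inf_le_right := PresCarrier.ind fun _ => PresCarrier.ind fun _ => Tm.Le.inf_le_right _ _
  le_inf := PresCarrier.ind fun _ => PresCarrier.ind fun _ => PresCarrier.ind fun _ => Tm.Le.le_inf
  le_sup_inf := PresCarrier.ind fun _ => PresCarrier.ind fun _ => PresCarrier.ind fun _ =>
    Tm.Le.distrib _ _ _

instance : BoundedOrder (PresCarrier R) where
  top := PresCarrier.mk R .top
  le_top := PresCarrier.ind fun _ => Tm.Le.le_top _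
  bot := PresCarrier.mk R .bot
  bot_le := PresCarrier.ind fun _ => Tm.Le.bot_le _

/-- The bounded distributive lattice (with monotone operators) presented by the generators `G`
and the inequations `R`. -/
def Pres : BddDistLat.{u} := BddDistLat.of (PresCarrier R)

/-- The class of a term. -/
def Pres.mk (t : Tm G ar) : Pres R := PresCarrier.mk R t

/-- The class of a generator. -/
def Pres.gen (g : G) : Pres R := Pres.mk R (.gen g)

variable {R} in
theorem Pres.ind {p : Pres R → Prop} (h : ∀ t, p (Pres.mk R t)) (q : Pres R) : p q :=
  PresCarrier.ind h q

variable {R} in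
theorem Pres.mk_le {s t : Tm G ar} : Pres.mk R s ≤ Pres.mk R t ↔ Tm.Le R s t := Iff.rfl

/-- The operators of the presented algebra. -/
noncomputable def Pres.op (o : O) (a : ar o → Pres R) : Pres R :=
  Pres.mk R (.op o fun i => Quotient.out (s := Tm.setoid R) (a i))

theorem Pres.op_mk (o : O) (ts : ar o → Tm G ar) :
    Pres.op R o (fun i => Pres.mk R (ts i)) = Pres.mk R (.op o ts) := by
  have h : ∀ i, (Tm.setoid R).r (Quotient.out (s := Tm.setoid R) (Pres.mk R (ts i))) (ts i) :=
    fun i => Quotient.mk_out (s := Tm.setoid R) (ts i)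
  exact Quotient.sound (s := Tm.setoid R)
    ⟨Tm.Le.op_mono o fun i => (h i).1, Tm.Le.op_mono o fun i => (h i).2⟩

theorem Pres.exists_rep {I : Type} (a : I → Pres R) :
    ∃ ts : I → Tm G ar, a = fun i => Pres.mk R (ts i) :=
  ⟨fun i => Quotient.out (s := Tm.setoid R) (a i),
    funext fun i => (Quotient.out_eq (s := Tm.setoid R) (a i)).symm⟩

theorem Pres.op_mono (o : O) : Monotone (Pres.op R o) := by
  intro a b h
  obtain ⟨s, rfl⟩ := Pres.exists_rep R a
  obtain ⟨t, rfl⟩ := Pres.exists_rep R b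
  rw [Pres.op_mk, Pres.op_mk]
  exact Tm.Le.op_mono o h

/-- Evaluation of terms in a bounded distributive lattice with operators. -/
def Tm.eval {C : BddDistLat.{u}} (f : G → C) (φ : (o : O) → (ar o → C) → C) : Tm G ar → C
  | .gen g => f g
  | .top => ⊤
  | .bot => ⊥
  | .sup s t => s.eval f φ ⊔ t.eval f φ
  | .inf s t => s.eval f φ ⊓ t.eval f φ
  | .op o ts => φ o fun i => (ts i).eval f φ

variable {R} in
theorem Tm.Le.eval_le {C : BddDistLat.{u}} {f : G → C} {φ : (o : O) → (ar o → C) → C}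
    (hφ : ∀ o, Monotone (φ o)) (hR : ∀ s t, R s t → s.eval f φ ≤ t.eval f φ) {s t : Tm G ar}
    (h : Tm.Le R s t) : s.eval f φ ≤ t.eval f φ := by
  induction h with
  | rel h => exact hR _ _ h
  | refl s => exact le_rfl
  | trans _ _ h k => exact h.trans k
  | le_top s => exact _root_.le_top
  | bot_le s => exact _root_.bot_le
  | le_sup_left s t => exact _root_.le_sup_left
  | le_sup_right s t => exact _root_.le_sup_right
  | sup_le _ _ h k => exact _root_.sup_le h k
  | inf_le_left s t => exact _root_.inf_le_left
  | inf_le_right s t => exact _root_.inf_le_right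
  | le_inf _ _ h k => exact _root_.le_inf h k
  | distrib s t r => exact _root_.le_sup_inf
  | op_mono o _ h => exact hφ o h

/-- The universal property of the presented algebra: existence. -/
def Pres.lift {C : BddDistLat.{u}} (f : G → C) (φ : (o : O) → (ar o → C) → C)
    (hφ : ∀ o, Monotone (φ o)) (hR : ∀ s t, R s t → s.eval f φ ≤ t.eval f φ) : Pres R ⟶ C :=
  BddDistLat.ofHom (X := PresCarrier R) (Y := C)
    { toFun := Quotient.lift (s := Tm.setoid R) (fun t => t.eval f φ)
        (fun _ _ h => le_antisymm (h.1.eval_le hφ hR) (h.2.eval_le hφ hR))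
      map_sup' := PresCarrier.ind fun _ => PresCarrier.ind fun _ => rfl
      map_inf' := PresCarrier.ind fun _ => PresCarrier.ind fun _ => rfl
      map_top' := rfl
      map_bot' := rfl }

section lift
variable {R} {C : BddDistLat.{u}} {f : G → C} {φ : (o : O) → (ar o → C) → C}
    {hφ : ∀ o, Monotone (φ o)} {hR : ∀ s t, R s t → s.eval f φ ≤ t.eval f φ}

theorem Pres.lift_mk (t : Tm G ar) : Pres.lift R f φ hφ hR (Pres.mk R t) = t.eval f φ := rfl

theorem Pres.lift_gen (g : G) : Pres.lift R f φ hφ hR (Pres.gen R g) = f g := rfl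

theorem Pres.lift_op (o : O) (a : ar o → Pres R) :
    Pres.lift R f φ hφ hR (Pres.op R o a) = φ o fun i => Pres.lift R f φ hφ hR (a i) := by
  obtain ⟨s, rfl⟩ := Pres.exists_rep R a
  rw [Pres.op_mk]
  rfl

theorem Pres.hom_le {p q : Pres R ⟶ C} (hg : ∀ g, p (Pres.gen R g) ≤ q (Pres.gen R g))
    (ho : ∀ o a, (∀ i, p (a i) ≤ q (a i)) → p (Pres.op R o a) ≤ q (Pres.op R o a))
    (x : Pres R) : p x ≤ q x := by
  revert x
  refine Pres.ind fun t => ?_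
  induction t with
  | gen g => exact hg g
  | top =>
    have h : Pres.mk R .top = ⊤ := rfl
    rw [h, map_top, map_top]
  | bot =>
    have h : Pres.mk R .bot = ⊥ := rfl
    rw [h, map_bot, map_bot]
  | sup s t hs ht =>
    have h : Pres.mk R (.sup s t) = Pres.mk R s ⊔ Pres.mk R t := rfl
    rw [h, map_sup, map_sup]
    exact sup_le_sup hs ht
  | inf s t hs ht =>
    have h : Pres.mk R (.inf s t) = Pres.mk R s ⊓ Pres.mk R t := rfl
    rw [h, map_inf, map_inf]
    exact inf_le_inf hs ht
  | op o ts h =>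
    rw [← Pres.op_mk]
    exact ho o _ h

/-- The universal property of the presented algebra: uniqueness. -/
theorem Pres.hom_ext {p q : Pres R ⟶ C} (hg : ∀ g, p (Pres.gen R g) = q (Pres.gen R g))
    (ho : ∀ o a, (∀ i, p (a i) = q (a i)) → p (Pres.op R o a) = q (Pres.op R o a)) : p = q := by
  have key : ∀ x, p x = q x := by
    refine Pres.ind fun t => ?_
    induction t with
    | gen g => exact hg g
    | top =>
      have h : Pres.mk R .top = ⊤ := rfl
      rw [h, map_top, map_top]
    | bot =>
      have h : Pres.mk R .bot = ⊥ := rfl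
      rw [h, map_bot, map_bot]
    | sup s t hs ht =>
      have h : Pres.mk R (.sup s t) = Pres.mk R s ⊔ Pres.mk R t := rfl
      rw [h, map_sup, map_sup, hs, ht]
    | inf s t hs ht =>
      have h : Pres.mk R (.inf s t) = Pres.mk R s ⊓ Pres.mk R t := rfl
      rw [h, map_inf, map_inf, hs, ht]
    | op o ts h =>
      rw [← Pres.op_mk]
      exact ho o _ h
  exact BddDistLat.ext key

end lift
end Presentation

/-- The pointwise order on lattice homomorphisms. -/
def HomLE {A C : BddDistLat.{u}} (f g : A ⟶ C) : Prop := ∀ a : A, f a ≤ g a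

/-! ### Coproducts of bounded distributive lattices -/

/-- The signature without operators. -/
def noOps : Empty → Type := fun e => e.elim

/-- The inequations saying that the map `e` from `A` into terms is a lattice homomorphism. -/
inductive HomRel (A : BddDistLat.{u}) {G : Type u} {O : Type} {ar : O → Type}
    (e : A → Tm G ar) : Tm G ar → Tm G ar → Prop
  | mono {a b : A} : a ≤ b → HomRel A e (e a) (e b)
  | top : HomRel A e .top (e ⊤)
  | bot : HomRel A e (e ⊥) .bot
  | sup (a b : A) : HomRel A e (e (a ⊔ b)) (.sup (e a) (e b))
  | inf (a b : A) : HomRel A e (.inf (e a) (e b)) (e (a ⊓ b))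

theorem HomRel.eval_le {A C : BddDistLat.{u}} {G : Type u} {O : Type} {ar : O → Type}
    {e : A → Tm G ar} {f : G → C} {φ : (o : O) → (ar o → C) → C} (h : A ⟶ C)
    (he : ∀ a, (e a).eval f φ = h a) {s t : Tm G ar} (hst : HomRel A e s t) :
    s.eval f φ ≤ t.eval f φ := by
  induction hst with
  | mono hab => rw [he, he]; exact OrderHomClass.mono h.hom hab
  | top => rw [he, map_top]; exact le_top
  | bot => rw [he, map_bot]; exact bot_le
  | sup a b => rw [he, map_sup, Tm.eval, he, he]
  | inf a b => rw [he, map_inf, Tm.eval, he, he]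

/-- If the inequations `R` force `e` to be a lattice homomorphism, this is it. -/
def HomRel.hom {A : BddDistLat.{u}} {G : Type u} {O : Type} {ar : O → Type}
    (e : A → Tm G ar) (R : Tm G ar → Tm G ar → Prop) (h : ∀ s t, HomRel A e s t → R s t) :
    A ⟶ Pres R :=
  BddDistLat.ofHom (X := A) (Y := PresCarrier R)
    { toFun := fun a => Pres.mk R (e a)
      map_sup' := fun a b => le_antisymm (Tm.Le.rel (h _ _ (.sup a b)))
        (Tm.Le.sup_le (.rel (h _ _ (.mono le_sup_left))) (.rel (h _ _ (.mono le_sup_right))))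
      map_inf' := fun a b => le_antisymm
        (Tm.Le.le_inf (.rel (h _ _ (.mono inf_le_left))) (.rel (h _ _ (.mono inf_le_right))))
        (Tm.Le.rel (h _ _ (.inf a b)))
      map_top' := le_antisymm (Tm.Le.le_top _) (Tm.Le.rel (h _ _ .top))
      map_bot' := le_antisymm (Tm.Le.rel (h _ _ .bot)) (Tm.Le.bot_le _) }

section Coprod
variable (A C : BddDistLat.{u})

/-- The inequations presenting the coproduct of `A` and `C` on the generators `A ⊕ C`. -/
def coprodRel : Tm (A ⊕ C) noOps → Tm (A ⊕ C) noOps → Prop := fun s t =>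
  HomRel A (fun a => .gen (.inl a)) s t ∨ HomRel C (fun c => .gen (.inr c)) s t

/-- The coproduct cocone. -/
def coprodCofan : BinaryCofan A C :=
  BinaryCofan.mk (P := Pres (coprodRel A C))
    (HomRel.hom (fun a => .gen (.inl a)) _ fun _ _ h => Or.inl h)
    (HomRel.hom (fun c => .gen (.inr c)) _ fun _ _ h => Or.inr h)

variable {A C} in
def coprodDesc {D : BddDistLat.{u}} (f : A ⟶ D) (g : C ⟶ D) : Pres (coprodRel A C) ⟶ D :=
  Pres.lift _ (Sum.elim f g) (fun o => o.elim) (fun o => o.elim) (by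
    rintro s t (h | h)
    · exact h.eval_le f fun _ => rfl
    · exact h.eval_le g fun _ => rfl)

theorem hasBinaryCoproduct : HasBinaryCoproduct A C :=
  HasColimit.mk ⟨coprodCofan A C, BinaryCofan.isColimitMk (fun s => coprodDesc s.inl s.inr)
    (fun s => BddDistLat.ext fun _ => rfl) (fun s => BddDistLat.ext fun _ => rfl)
    (fun s m h k => Pres.hom_ext
      (by
        rintro (a | c)
        · exact ConcreteCategory.congr_hom h a
        · exact ConcreteCategory.congr_hom k c)
      (fun o => o.elim))⟩

instance : HasBinaryCoproducts BddDistLat.{u} :=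
  haveI := fun {A C : BddDistLat.{u}} => hasBinaryCoproduct A C
  hasBinaryCoproducts_of_hasColimit_pair _

end Coprod

/-- For an endofunctor `F`, the endofunctor `id + F`. -/
noncomputable def idPlus (F : BddDistLat.{u} ⥤ BddDistLat.{u}) :
    BddDistLat.{u} ⥤ BddDistLat.{u} where
  obj A := A ⨿ F.obj A
  map f := coprod.map f (F.map f)

/-! ### Unfolding systems and their semantic maps, over distributive lattices -/

/-- The contravariant powerset functor into bounded distributive lattices. -/
def Pow : (Type u)ᵒᵖ ⥤ BddDistLat.{u} where
  obj X := BddDistLat.of (Set X.unop)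
  map f := BddDistLat.ofHom
    { toFun := fun U => f.unop ⁻¹' U
      map_sup' := fun _ _ => rfl
      map_inf' := fun _ _ => rfl
      map_top' := rfl
      map_bot' := rfl }

/-- An endofunctor is `Poset`-enriched if it is monotone on hom-sets. -/
def IsEnriched (F : BddDistLat.{u} ⥤ BddDistLat.{u}) : Prop :=
  ∀ ⦃A C : BddDistLat.{u}⦄ (f g : A ⟶ C), HomLE f g → HomLE (F.map f) (F.map g)

/-- An unfolding system for the endofunctor `B` of sets: a one-step logic `(L0, δ)` and a
natural transformation `unf : L ⟶ id + L0 L`, where `L0` and `L` are `Poset`-enriched and `L` has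
an initial algebra. -/
structure UnfoldingSystem (B : Type u ⥤ Type u) where
  L0 : BddDistLat.{u} ⥤ BddDistLat.{u}
  L : BddDistLat.{u} ⥤ BddDistLat.{u}
  L0_enriched : IsEnriched L0
  L_enriched : IsEnriched L
  hasInitial : HasInitial (Endofunctor.Algebra L)
  δ : Pow ⋙ L0 ⟶ B.op ⋙ Pow
  unf : L ⟶ idPlus (L ⋙ L0)

namespace UnfoldingSystem

variable {B : Type u ⥤ Type u} (S : UnfoldingSystem B)

/-- The operator on maps `t : Φ ⟶ P X` whose least fixpoint is the semantic map:
`Φ ⟶ L Φ ⟶ Φ + L0 L Φ ⟶ Φ + L0 Φ ⟶ P X + L0 P X ⟶ P X + P B X ⟶ P X`. -/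
noncomputable def step {Φ : Endofunctor.Algebra S.L} (hΦ : IsInitial Φ)
    {X : Type u} (σ : X ⟶ B.obj X) (t : Φ.a ⟶ Pow.obj (op X)) : Φ.a ⟶ Pow.obj (op X) :=
  Endofunctor.Algebra.Initial.strInv hΦ ≫ S.unf.app Φ.a ≫
    coprod.map (𝟙 Φ.a) (S.L0.map Φ.str) ≫ coprod.map t (S.L0.map t) ≫
      coprod.map (𝟙 (Pow.obj (op X))) (S.δ.app (op X)) ≫
        coprod.desc (𝟙 (Pow.obj (op X))) (Pow.map σ.op)

/-- `t` is the semantic map of the unfolding system on the coalgebra `σ`: the least map that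
makes the defining diagram commute. -/
def IsSemanticMap {Φ : Endofunctor.Algebra S.L} (hΦ : IsInitial Φ)
    {X : Type u} (σ : X ⟶ B.obj X) (t : Φ.a ⟶ Pow.obj (op X)) : Prop :=
  t = S.step hΦ σ t ∧ ∀ t' : Φ.a ⟶ Pow.obj (op X), t' = S.step hΦ σ t' → HomLE t t'

end UnfoldingSystem

/-! ### The functor of a family of monotone operators, and free algebras -/

section Logic

variable {O : Type} (ar : O → Type)

/-- The inequations `o(a) ≤ o(b)` for `a ≤ b`, between generators `o(a)` with `a : ar o → A`. -/
def opRel (A : BddDistLat.{u}) (s t : Tm (Σ o : O, ar o → A) noOps) : Prop :=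
  ∃ (o : O) (a b : ar o → A), a ≤ b ∧ s = .gen ⟨o, a⟩ ∧ t = .gen ⟨o, b⟩

/-- The generator `o(a)`. -/
def opGen {A : BddDistLat.{u}} (o : O) (a : ar o → A) : Pres (opRel ar A) :=
  Pres.gen _ ⟨o, a⟩

theorem opGen_mono {A : BddDistLat.{u}} (o : O) : Monotone (opGen ar (A := A) o) :=
  fun a b h => Tm.Le.rel (R := opRel ar A) ⟨o, a, b, h, rfl, rfl⟩

def opLift {A C : BddDistLat.{u}} (φ : (o : O) → (ar o → A) → C) (hφ : ∀ o, Monotone (φ o)) :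
    Pres (opRel ar A) ⟶ C :=
  Pres.lift _ (fun g => φ g.1 g.2) (fun o => o.elim) (fun o => o.elim) (by
    rintro _ _ ⟨o, a, b, h, rfl, rfl⟩
    exact hφ o h)

theorem opLift_gen {A C : BddDistLat.{u}} (φ : (o : O) → (ar o → A) → C)
    (hφ : ∀ o, Monotone (φ o)) (o : O) (a : ar o → A) :
    opLift ar φ hφ (opGen ar o a) = φ o a := rfl

variable {ar} in
theorem op_hom_ext {A C : BddDistLat.{u}} {f g : Pres (opRel ar A) ⟶ C}
    (h : ∀ o a, f (opGen ar o a) = g (opGen ar o a)) : f = g :=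
  Pres.hom_ext (fun x => h x.1 x.2) (fun o => o.elim)

/-- The functor `A ↦ Free {o(a) | o : O, a : ar o → A} / ≈`, where `≈` is the least congruence
such that `o(a) ≤ o(b)` whenever `a ≤ b`. -/
def opFunctor : BddDistLat.{u} ⥤ BddDistLat.{u} where
  obj A := Pres (opRel ar A)
  map f := opLift ar (fun o a => opGen ar o (fun i => f (a i)))
    (fun o _ _ h => opGen_mono ar o fun i => OrderHomClass.mono f.hom (h i))
  map_id _ := op_hom_ext fun _ _ => rfl
  map_comp _ _ := op_hom_ext fun _ _ => rfl

theorem opFunctor_enriched : IsEnriched (opFunctor.{u} ar) :=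
  fun _ _ _ _ h => Pres.hom_le (fun g => opGen_mono ar g.1 fun i => h (g.2 i)) (fun o => o.elim)

end Logic

section Free

variable {O₀ O₁ : Type} (ar₀ : O₀ → Type) (ar₁ : O₁ → Type)

/-- The arities of the joint signature `O₀ ⊕ O₁`. -/
abbrev arity : O₀ ⊕ O₁ → Type := Sum.elim ar₀ ar₁

/-- The carrier of the free `(L0 + L)`-algebra over `A`, for `L0 = opFunctor ar₀` and
`L = opFunctor ar₁`: the lattice of `(L0 + L)`-terms with generators from `A`. -/
def FreeObj (A : BddDistLat.{u}) : BddDistLat.{u} :=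
  Pres (G := A) (ar := arity ar₀ ar₁) (HomRel A .gen)

/-- The insertion of generators. -/
def FreeObj.η (A : BddDistLat.{u}) : A ⟶ FreeObj ar₀ ar₁ A :=
  HomRel.hom .gen _ fun _ _ h => h

/-- Application of an operator of the joint signature to terms. -/
noncomputable def FreeObj.op (A : BddDistLat.{u}) (o : O₀ ⊕ O₁)
    (a : arity ar₀ ar₁ o → FreeObj ar₀ ar₁ A) : FreeObj ar₀ ar₁ A :=
  Pres.op (G := A) (ar := arity ar₀ ar₁) (HomRel A .gen) o a

theorem FreeObj.op_mono (A : BddDistLat.{u}) (o : O₀ ⊕ O₁) :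
    Monotone (FreeObj.op ar₀ ar₁ A o) :=
  Pres.op_mono (G := A) (ar := arity ar₀ ar₁) (HomRel A .gen) o

/-- The `L0`-algebra structure. -/
noncomputable def FreeObj.str₀ (A : BddDistLat.{u}) :
    (opFunctor ar₀).obj (FreeObj ar₀ ar₁ A) ⟶ FreeObj ar₀ ar₁ A :=
  opLift ar₀ (fun o => FreeObj.op ar₀ ar₁ A (.inl o)) (fun o => FreeObj.op_mono ar₀ ar₁ A (.inl o))

/-- The `L`-algebra structure. -/
noncomputable def FreeObj.str₁ (A : BddDistLat.{u}) :
    (opFunctor ar₁).obj (FreeObj ar₀ ar₁ A) ⟶ FreeObj ar₀ ar₁ A :=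
  opLift ar₁ (fun o => FreeObj.op ar₀ ar₁ A (.inr o)) (fun o => FreeObj.op_mono ar₀ ar₁ A (.inr o))

variable {ar₀ ar₁} {A C D : BddDistLat.{u}}

/-- The operators on an `(L0 + L)`-algebra. -/
def algOp (l₀ : (opFunctor ar₀).obj C ⟶ C) (l₁ : (opFunctor ar₁).obj C ⟶ C) :
    (o : O₀ ⊕ O₁) → (arity ar₀ ar₁ o → C) → C
  | .inl o => fun a => l₀ (opGen ar₀ o a)
  | .inr o => fun a => l₁ (opGen ar₁ o a)

theorem algOp_mono (l₀ : (opFunctor ar₀).obj C ⟶ C) (l₁ : (opFunctor ar₁).obj C ⟶ C) :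
    ∀ o, Monotone (algOp l₀ l₁ o)
  | .inl o => fun _ _ h => OrderHomClass.mono l₀.hom (opGen_mono ar₀ o h)
  | .inr o => fun _ _ h => OrderHomClass.mono l₁.hom (opGen_mono ar₁ o h)

section
variable (f : A ⟶ C) (l₀ : (opFunctor ar₀).obj C ⟶ C) (l₁ : (opFunctor ar₁).obj C ⟶ C)

/-- Freeness: every lattice homomorphism from `A` into an `(L0 + L)`-algebra extends. -/
def FreeObj.lift : FreeObj ar₀ ar₁ A ⟶ C :=
  Pres.lift (G := A) (ar := arity ar₀ ar₁) (HomRel A .gen) f (algOp l₀ l₁) (algOp_mono l₀ l₁)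
    (fun _ _ h => h.eval_le f fun _ => rfl)

theorem FreeObj.lift_op (o : O₀ ⊕ O₁) (a : arity ar₀ ar₁ o → FreeObj ar₀ ar₁ A) :
    FreeObj.lift f l₀ l₁ (FreeObj.op ar₀ ar₁ A o a) =
      algOp l₀ l₁ o (fun i => FreeObj.lift f l₀ l₁ (a i)) :=
  Pres.lift_op (G := A) (ar := arity ar₀ ar₁) (R := HomRel A .gen) o a

theorem FreeObj.η_lift : FreeObj.η ar₀ ar₁ A ≫ FreeObj.lift f l₀ l₁ = f := rfl

theorem FreeObj.str₀_lift : FreeObj.str₀ ar₀ ar₁ A ≫ FreeObj.lift f l₀ l₁ =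
    (opFunctor ar₀).map (FreeObj.lift f l₀ l₁) ≫ l₀ :=
  op_hom_ext fun o a => FreeObj.lift_op f l₀ l₁ (.inl o) a

theorem FreeObj.str₁_lift : FreeObj.str₁ ar₀ ar₁ A ≫ FreeObj.lift f l₀ l₁ =
    (opFunctor ar₁).map (FreeObj.lift f l₀ l₁) ≫ l₁ :=
  op_hom_ext fun o a => FreeObj.lift_op f l₀ l₁ (.inr o) a
end

/-- Freeness: the extension is unique. -/
theorem FreeObj.lift_unique {l₀ : (opFunctor ar₀).obj C ⟶ C} {l₁ : (opFunctor ar₁).obj C ⟶ C}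
    {p q : FreeObj ar₀ ar₁ A ⟶ C}
    (hη : FreeObj.η ar₀ ar₁ A ≫ p = FreeObj.η ar₀ ar₁ A ≫ q)
    (hp₀ : FreeObj.str₀ ar₀ ar₁ A ≫ p = (opFunctor ar₀).map p ≫ l₀)
    (hq₀ : FreeObj.str₀ ar₀ ar₁ A ≫ q = (opFunctor ar₀).map q ≫ l₀)
    (hp₁ : FreeObj.str₁ ar₀ ar₁ A ≫ p = (opFunctor ar₁).map p ≫ l₁)
    (hq₁ : FreeObj.str₁ ar₀ ar₁ A ≫ q = (opFunctor ar₁).map q ≫ l₁) : p = q := by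
  refine Pres.hom_ext (G := A) (ar := arity ar₀ ar₁) (R := HomRel A .gen)
    (fun g => ConcreteCategory.congr_hom hη g) ?_
  rintro (o | o) a h
  · have h1 : p (FreeObj.op ar₀ ar₁ A (.inl o) a) = l₀ (opGen ar₀ o fun i => p (a i)) :=
      ConcreteCategory.congr_hom hp₀ (opGen ar₀ o a)
    have h2 : q (FreeObj.op ar₀ ar₁ A (.inl o) a) = l₀ (opGen ar₀ o fun i => q (a i)) :=
      ConcreteCategory.congr_hom hq₀ (opGen ar₀ o a)
    exact h1.trans ((congrArg (fun b => l₀ (opGen ar₀ o b)) (funext h)).trans h2.symm)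
  · have h1 : p (FreeObj.op ar₀ ar₁ A (.inr o) a) = l₁ (opGen ar₁ o fun i => p (a i)) :=
      ConcreteCategory.congr_hom hp₁ (opGen ar₁ o a)
    have h2 : q (FreeObj.op ar₀ ar₁ A (.inr o) a) = l₁ (opGen ar₁ o fun i => q (a i)) :=
      ConcreteCategory.congr_hom hq₁ (opGen ar₁ o a)
    exact h1.trans ((congrArg (fun b => l₁ (opGen ar₁ o b)) (funext h)).trans h2.symm)

/-- The action of the free algebra construction on morphisms. -/
noncomputable def FreeObj.map (f : A ⟶ C) : FreeObj ar₀ ar₁ A ⟶ FreeObj ar₀ ar₁ C :=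
  FreeObj.lift (f ≫ FreeObj.η ar₀ ar₁ C) (FreeObj.str₀ ar₀ ar₁ C) (FreeObj.str₁ ar₀ ar₁ C)

variable (ar₀ ar₁)

theorem FreeObj.η_map (f : A ⟶ C) :
    FreeObj.η ar₀ ar₁ A ≫ FreeObj.map f = f ≫ FreeObj.η ar₀ ar₁ C := rfl

theorem FreeObj.str₀_map (f : A ⟶ C) : FreeObj.str₀ ar₀ ar₁ A ≫ FreeObj.map f =
    (opFunctor ar₀).map (FreeObj.map f) ≫ FreeObj.str₀ ar₀ ar₁ C :=
  FreeObj.str₀_lift _ _ _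

theorem FreeObj.str₁_map (f : A ⟶ C) : FreeObj.str₁ ar₀ ar₁ A ≫ FreeObj.map f =
    (opFunctor ar₁).map (FreeObj.map f) ≫ FreeObj.str₁ ar₀ ar₁ C :=
  FreeObj.str₁_lift _ _ _

/-- The functor `T` underlying the algebraically free monad on `L0 + L`. -/
noncomputable def freeFunctor : BddDistLat.{u} ⥤ BddDistLat.{u} where
  obj A := FreeObj ar₀ ar₁ A
  map f := FreeObj.map f
  map_id A := FreeObj.lift_unique (l₀ := FreeObj.str₀ ar₀ ar₁ A) (l₁ := FreeObj.str₁ ar₀ ar₁ A)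
    rfl (FreeObj.str₀_lift _ _ _) (by simp) (FreeObj.str₁_lift _ _ _) (by simp)
  map_comp {A C D} f g := FreeObj.lift_unique
    (l₀ := FreeObj.str₀ ar₀ ar₁ D) (l₁ := FreeObj.str₁ ar₀ ar₁ D) rfl (FreeObj.str₀_lift _ _ _)
    (by simp only [FreeObj.str₀_map, reassoc_of% FreeObj.str₀_map, Functor.map_comp, Category.assoc])
    (FreeObj.str₁_lift _ _ _)
    (by simp only [FreeObj.str₁_map, reassoc_of% FreeObj.str₁_map, Functor.map_comp, Category.assoc])

theorem freeFunctor_enriched : IsEnriched (freeFunctor.{u} ar₀ ar₁) := by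
  intro A C f g h
  refine Pres.hom_le (G := A) (ar := arity ar₀ ar₁) (R := HomRel A .gen)
    (fun a => OrderHomClass.mono (FreeObj.η ar₀ ar₁ C).hom (h a)) ?_
  intro o a hi
  have h1 := FreeObj.lift_op (f ≫ FreeObj.η ar₀ ar₁ C) (FreeObj.str₀ ar₀ ar₁ C)
    (FreeObj.str₁ ar₀ ar₁ C) o a
  have h2 := FreeObj.lift_op (g ≫ FreeObj.η ar₀ ar₁ C) (FreeObj.str₀ ar₀ ar₁ C)
    (FreeObj.str₁ ar₀ ar₁ C) o a
  exact h1.le.trans (le_trans (algOp_mono _ _ o hi) h2.ge)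

/-- The multiplication of the monad `T`. -/
noncomputable def FreeObj.mul (A : BddDistLat.{u}) :
    FreeObj ar₀ ar₁ (FreeObj ar₀ ar₁ A) ⟶ FreeObj ar₀ ar₁ A :=
  FreeObj.lift (𝟙 _) (FreeObj.str₀ ar₀ ar₁ A) (FreeObj.str₁ ar₀ ar₁ A)

theorem FreeObj.mul_naturality (f : A ⟶ C) :
    FreeObj.map (FreeObj.map f) ≫ FreeObj.mul ar₀ ar₁ C =
      FreeObj.mul ar₀ ar₁ A ≫ FreeObj.map f :=
  FreeObj.lift_unique (l₀ := FreeObj.str₀ ar₀ ar₁ C) (l₁ := FreeObj.str₁ ar₀ ar₁ C) rfl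
    (by simp only [FreeObj.mul, reassoc_of% str₀_map, FreeObj.str₀_lift, Functor.map_comp,
      Category.assoc])
    (by simp only [FreeObj.mul, str₀_map, reassoc_of% FreeObj.str₀_lift, Functor.map_comp,
      Category.assoc])
    (by simp only [FreeObj.mul, reassoc_of% str₁_map, FreeObj.str₁_lift, Functor.map_comp,
      Category.assoc])
    (by simp only [FreeObj.mul, str₁_map, reassoc_of% FreeObj.str₁_lift, Functor.map_comp,
      Category.assoc])

end Free

/-! ### The initial algebra of the functor `T` -/

section Initial

variable {O₀ O₁ : Type} (ar₀ : O₀ → Type) (ar₁ : O₁ → Type)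

/-- The joint signature with one further unary operator `none`, for the insertion of generators. -/
def boxArity : Option (O₀ ⊕ O₁) → Type
  | none => Unit
  | some o => arity ar₀ ar₁ o

/-- The additional unary operator on terms. -/
def boxTm {G : Type u} (t : Tm G (boxArity ar₀ ar₁)) : Tm G (boxArity ar₀ ar₁) :=
  .op none fun _ => t

/-- The inequations saying that the additional operator is a lattice homomorphism. -/
inductive BoxRel : Tm PEmpty.{u + 1} (boxArity ar₀ ar₁) →
    Tm PEmpty.{u + 1} (boxArity ar₀ ar₁) → Prop
  | top : BoxRel .top (boxTm ar₀ ar₁ .top)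
  | bot : BoxRel (boxTm ar₀ ar₁ .bot) .bot
  | sup (s t) : BoxRel (boxTm ar₀ ar₁ (.sup s t)) (.sup (boxTm ar₀ ar₁ s) (boxTm ar₀ ar₁ t))
  | inf (s t) : BoxRel (.inf (boxTm ar₀ ar₁ s) (boxTm ar₀ ar₁ t)) (boxTm ar₀ ar₁ (.inf s t))

/-- The carrier of the initial `T`-algebra. -/
def InitObj : BddDistLat.{u} := Pres (BoxRel.{u} ar₀ ar₁)

noncomputable def InitObj.op (o : O₀ ⊕ O₁) (a : arity ar₀ ar₁ o → InitObj.{u} ar₀ ar₁) :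
    InitObj.{u} ar₀ ar₁ := Pres.op (BoxRel.{u} ar₀ ar₁) (some o) a

theorem InitObj.op_mono (o : O₀ ⊕ O₁) : Monotone (InitObj.op.{u} ar₀ ar₁ o) :=
  Pres.op_mono (BoxRel.{u} ar₀ ar₁) (some o)

theorem Pres.op_none_mk (t : Tm PEmpty.{u + 1} (boxArity ar₀ ar₁)) :
    Pres.op (BoxRel.{u} ar₀ ar₁) none (fun _ => Pres.mk _ t) = Pres.mk _ (boxTm ar₀ ar₁ t) :=
  Pres.op_mk (BoxRel.{u} ar₀ ar₁) none fun _ => t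

/-- The additional operator. -/
noncomputable def InitObj.box : InitObj.{u} ar₀ ar₁ ⟶ InitObj.{u} ar₀ ar₁ :=
  BddDistLat.ofHom (X := PresCarrier (BoxRel.{u} ar₀ ar₁)) (Y := PresCarrier (BoxRel.{u} ar₀ ar₁))
    { toFun := fun a => Pres.op (BoxRel.{u} ar₀ ar₁) none fun _ => a
      map_sup' := PresCarrier.ind fun s => PresCarrier.ind fun t => by
        have h := Pres.op_mono (BoxRel.{u} ar₀ ar₁) none
        refine le_antisymm ?_ (sup_le (h fun _ => le_sup_left) (h fun _ => le_sup_right))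
        refine (Pres.op_none_mk ar₀ ar₁ (.sup s t)).le.trans
          ((Tm.Le.rel (.sup s t) : Pres.mk (BoxRel.{u} ar₀ ar₁) _ ≤ Pres.mk _ _).trans ?_)
        exact (congrArg₂ (· ⊔ ·) (Pres.op_none_mk ar₀ ar₁ s) (Pres.op_none_mk ar₀ ar₁ t)).ge
      map_inf' := PresCarrier.ind fun s => PresCarrier.ind fun t => by
        have h := Pres.op_mono (BoxRel.{u} ar₀ ar₁) none
        refine le_antisymm (le_inf (h fun _ => inf_le_left) (h fun _ => inf_le_right)) ?_
        refine (congrArg₂ (· ⊓ ·) (Pres.op_none_mk ar₀ ar₁ s)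
          (Pres.op_none_mk ar₀ ar₁ t)).le.trans
          ((Tm.Le.rel (.inf s t) : Pres.mk (BoxRel.{u} ar₀ ar₁) _ ≤ Pres.mk _ _).trans ?_)
        exact (Pres.op_none_mk ar₀ ar₁ (.inf s t)).ge
      map_top' := le_antisymm le_top
        ((Tm.Le.rel .top : Pres.mk (BoxRel.{u} ar₀ ar₁) _ ≤ Pres.mk _ _).trans
          (Pres.op_none_mk ar₀ ar₁ .top).ge)
      map_bot' := le_antisymm ((Pres.op_none_mk ar₀ ar₁ .bot).le.trans
        (Tm.Le.rel .bot : Pres.mk (BoxRel.{u} ar₀ ar₁) _ ≤ Pres.mk _ _)) bot_le }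

/-- The structure map of the initial `T`-algebra. -/
noncomputable def InitObj.str : FreeObj ar₀ ar₁ (InitObj.{u} ar₀ ar₁) ⟶ InitObj.{u} ar₀ ar₁ :=
  FreeObj.lift (InitObj.box ar₀ ar₁)
    (opLift ar₀ (fun o => InitObj.op ar₀ ar₁ (.inl o)) fun o => InitObj.op_mono ar₀ ar₁ (.inl o))
    (opLift ar₁ (fun o => InitObj.op ar₀ ar₁ (.inr o)) fun o => InitObj.op_mono ar₀ ar₁ (.inr o))

theorem InitObj.str_op (o : O₀ ⊕ O₁)
    (a : arity ar₀ ar₁ o → FreeObj ar₀ ar₁ (InitObj.{u} ar₀ ar₁)) :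
    InitObj.str ar₀ ar₁ (FreeObj.op ar₀ ar₁ _ o a) =
      InitObj.op ar₀ ar₁ o (fun i => InitObj.str ar₀ ar₁ (a i)) := by
  refine (FreeObj.lift_op _ _ _ o a).trans ?_
  cases o <;> rfl

theorem FreeObj.map_op {A C : BddDistLat.{u}} (f : A ⟶ C) (o : O₀ ⊕ O₁)
    (a : arity ar₀ ar₁ o → FreeObj ar₀ ar₁ A) :
    FreeObj.map f (FreeObj.op ar₀ ar₁ A o a) =
      FreeObj.op ar₀ ar₁ C o (fun i => FreeObj.map f (a i)) := by
  refine (FreeObj.lift_op _ _ _ o a).trans ?_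
  cases o <;> rfl

variable {C : BddDistLat.{u}} (β : FreeObj ar₀ ar₁ C ⟶ C)

noncomputable def initPreOp : (o : Option (O₀ ⊕ O₁)) →
    (boxArity ar₀ ar₁ o → FreeObj ar₀ ar₁ C) → FreeObj ar₀ ar₁ C
  | none => fun a => FreeObj.η ar₀ ar₁ C (β (a ()))
  | some o => fun a => FreeObj.op ar₀ ar₁ C o a

/-- The unique map from the initial algebra into the `T`-algebra `β`, before applying `β`. -/
noncomputable def initPre : InitObj.{u} ar₀ ar₁ ⟶ FreeObj ar₀ ar₁ C :=
  Pres.lift (BoxRel.{u} ar₀ ar₁) PEmpty.elim (initPreOp ar₀ ar₁ β)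
    (fun o => match o with
      | none => fun _ _ h => OrderHomClass.mono (FreeObj.η ar₀ ar₁ C).hom
          (OrderHomClass.mono β.hom (h ()))
      | some o => FreeObj.op_mono ar₀ ar₁ C o)
    (by
      intro s t h
      cases h with
      | top => exact ((map_top (FreeObj.η ar₀ ar₁ C).hom).symm.trans
          (congrArg _ (map_top β.hom).symm)).le
      | bot => exact ((congrArg (FreeObj.η ar₀ ar₁ C).hom (map_bot β.hom)).trans
          (map_bot (FreeObj.η ar₀ ar₁ C).hom)).le
      | sup s t => exact ((congrArg (FreeObj.η ar₀ ar₁ C).hom (map_sup β.hom _ _)).trans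
          (map_sup (FreeObj.η ar₀ ar₁ C).hom _ _)).le
      | inf s t => exact ((congrArg (FreeObj.η ar₀ ar₁ C).hom (map_inf β.hom _ _)).trans
          (map_inf (FreeObj.η ar₀ ar₁ C).hom _ _)).ge)

theorem initPre_op (o : O₀ ⊕ O₁) (a : arity ar₀ ar₁ o → InitObj.{u} ar₀ ar₁) :
    initPre ar₀ ar₁ β (InitObj.op ar₀ ar₁ o a) =
      FreeObj.op ar₀ ar₁ C o (fun i => initPre ar₀ ar₁ β (a i)) :=
  Pres.lift_op (R := BoxRel.{u} ar₀ ar₁) (φ := initPreOp ar₀ ar₁ β) (some o) a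

theorem initPre_box (a : InitObj.{u} ar₀ ar₁) :
    initPre ar₀ ar₁ β (InitObj.box ar₀ ar₁ a) =
      FreeObj.η ar₀ ar₁ C (β (initPre ar₀ ar₁ β a)) :=
  Pres.lift_op (R := BoxRel.{u} ar₀ ar₁) (φ := initPreOp ar₀ ar₁ β) none fun _ => a

theorem InitObj.hom_ext {D : BddDistLat.{u}} {p q : InitObj.{u} ar₀ ar₁ ⟶ D}
    (hb : ∀ a, p a = q a → p (InitObj.box ar₀ ar₁ a) = q (InitObj.box ar₀ ar₁ a))
    (ho : ∀ o a, (∀ i, p (a i) = q (a i)) →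
      p (InitObj.op ar₀ ar₁ o a) = q (InitObj.op ar₀ ar₁ o a)) : p = q := by
  refine Pres.hom_ext (R := BoxRel.{u} ar₀ ar₁) (fun g => g.elim) ?_
  rintro (_ | o) a h
  · exact hb (a ()) (h ())
  · exact ho o a h

theorem FreeObj.hom_ext {A D : BddDistLat.{u}} {p q : FreeObj ar₀ ar₁ A ⟶ D}
    (hg : ∀ a, p (FreeObj.η ar₀ ar₁ A a) = q (FreeObj.η ar₀ ar₁ A a))
    (ho : ∀ o a, (∀ i, p (a i) = q (a i)) →
      p (FreeObj.op ar₀ ar₁ A o a) = q (FreeObj.op ar₀ ar₁ A o a)) : p = q :=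
  Pres.hom_ext (G := A) (ar := arity ar₀ ar₁) (R := HomRel A .gen) hg ho

theorem init_str_comp : FreeObj.map (initPre ar₀ ar₁ β ≫ β) =
    InitObj.str ar₀ ar₁ ≫ initPre ar₀ ar₁ β := by
  refine FreeObj.hom_ext ar₀ ar₁ (fun a => ?_) (fun o a h => ?_)
  · exact (initPre_box ar₀ ar₁ β a).symm
  · rw [FreeObj.map_op, BddDistLat.comp_apply, InitObj.str_op, initPre_op]
    exact congrArg _ (funext h)

theorem initPre_str : initPre ar₀ ar₁ (InitObj.str.{u} ar₀ ar₁) ≫ InitObj.str ar₀ ar₁ = 𝟙 _ := by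
  refine InitObj.hom_ext ar₀ ar₁ (fun a h => ?_) (fun o a h => ?_)
  · rw [BddDistLat.comp_apply, initPre_box]
    exact congrArg (InitObj.box ar₀ ar₁) h
  · rw [BddDistLat.comp_apply, initPre_op, InitObj.str_op]
    exact congrArg (InitObj.op ar₀ ar₁ o) (funext h)

theorem init_unique (g : InitObj.{u} ar₀ ar₁ ⟶ C)
    (hg : FreeObj.map g ≫ β = InitObj.str ar₀ ar₁ ≫ g) : g = initPre ar₀ ar₁ β ≫ β := by
  have key : initPre ar₀ ar₁ (InitObj.str.{u} ar₀ ar₁) ≫ FreeObj.map g = initPre ar₀ ar₁ β := by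
    refine InitObj.hom_ext ar₀ ar₁ (fun a h => ?_) (fun o a h => ?_)
    · rw [BddDistLat.comp_apply, initPre_box, initPre_box, ← h]
      exact congrArg (FreeObj.η ar₀ ar₁ C) (ConcreteCategory.congr_hom hg _).symm
    · rw [BddDistLat.comp_apply, initPre_op, initPre_op, FreeObj.map_op]
      exact congrArg _ (funext h)
  rw [← key, Category.assoc, hg, ← Category.assoc, initPre_str, Category.id_comp]

/-- The initial `T`-algebra. -/
noncomputable def initAlg : Endofunctor.Algebra (freeFunctor.{u} ar₀ ar₁) where
  a := InitObj ar₀ ar₁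
  str := InitObj.str ar₀ ar₁

noncomputable def initAlgIsInitial : IsInitial (initAlg.{u} ar₀ ar₁) :=
  IsInitial.ofUniqueHom
    (fun A =>
      { f := initPre ar₀ ar₁ A.str ≫ A.str
        h := (congrArg (· ≫ A.str) (init_str_comp ar₀ ar₁ A.str)).trans (Category.assoc _ _ _) })
    (fun A m => Endofunctor.Algebra.ext (init_unique ar₀ ar₁ A.str m.f m.h))

theorem freeFunctor_hasInitial : HasInitial (Endofunctor.Algebra (freeFunctor.{u} ar₀ ar₁)) :=
  (initAlgIsInitial ar₀ ar₁).hasInitial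

end Initial

/-! ### From `unf : L ⟶ id + L0 T` to an unfolding `T ⟶ id + L0 T` -/

section Depth

variable {O₀ O₁ : Type} {ar₀ : O₀ → Type} {ar₁ : O₁ → Type}
  (unf : opFunctor.{u} ar₁ ⟶ idPlus (freeFunctor ar₀ ar₁ ⋙ opFunctor ar₀))

/-- Abbreviation for the object `A + L0 T A`. -/
noncomputable abbrev unfObj (ar₀ : O₀ → Type) (ar₁ : O₁ → Type) (A : BddDistLat.{u}) :
    BddDistLat.{u} :=
  A ⨿ (opFunctor ar₀).obj (FreeObj ar₀ ar₁ A)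

/-- The action of `id + L0 T` on morphisms. -/
noncomputable abbrev unfObjMap {A C : BddDistLat.{u}} (f : A ⟶ C) :
    unfObj ar₀ ar₁ A ⟶ unfObj ar₀ ar₁ C :=
  coprod.map f ((opFunctor ar₀).map (FreeObj.map f))

/-- The component of `unf` at `A`. -/
noncomputable def unfApp (A : BddDistLat.{u}) :
    (opFunctor ar₁).obj A ⟶ unfObj ar₀ ar₁ A := unf.app A

theorem unfApp_naturality {A C : BddDistLat.{u}} (f : A ⟶ C) :
    (opFunctor ar₁).map f ≫ unfApp unf C = unfApp unf A ≫ unfObjMap f :=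
  unf.naturality f

/-- The canonical map `A + L0 T A ⟶ T A`. -/
noncomputable def fold (A : BddDistLat.{u}) : unfObj ar₀ ar₁ A ⟶ FreeObj ar₀ ar₁ A :=
  coprod.desc (FreeObj.η ar₀ ar₁ A) (FreeObj.str₀ ar₀ ar₁ A)

/-- The `L0`-algebra structure `L0 (A + L0 T A) ⟶ L0 T A ⟶ A + L0 T A`. -/
noncomputable def depthAlg₀ (A : BddDistLat.{u}) :
    (opFunctor ar₀).obj (unfObj ar₀ ar₁ A) ⟶ unfObj ar₀ ar₁ A :=
  (opFunctor ar₀).map (fold A) ≫ coprod.inr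

/-- The `L`-algebra structure
`L (A + L0 T A) ⟶ (A + L0 T A) + L0 T (A + L0 T A) ⟶ (A + L0 T A) + L0 T T A
  ⟶ (A + L0 T A) + L0 T A ⟶ A + L0 T A`. -/
noncomputable def depthAlg₁ (A : BddDistLat.{u}) :
    (opFunctor ar₁).obj (unfObj ar₀ ar₁ A) ⟶ unfObj ar₀ ar₁ A :=
  unfApp unf (unfObj ar₀ ar₁ A) ≫
    coprod.map (𝟙 (unfObj ar₀ ar₁ A)) ((opFunctor ar₀).map (FreeObj.map (fold A))) ≫
    coprod.map (𝟙 (unfObj ar₀ ar₁ A)) ((opFunctor ar₀).map (FreeObj.mul ar₀ ar₁ A)) ≫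
    coprod.desc (𝟙 (unfObj ar₀ ar₁ A)) coprod.inr

theorem fold_naturality {A C : BddDistLat.{u}} (f : A ⟶ C) :
    unfObjMap f ≫ fold C = fold (ar₀ := ar₀) (ar₁ := ar₁) A ≫ FreeObj.map f := by
  apply coprod.hom_ext
  · rw [coprod.inl_map_assoc, fold, fold, coprod.inl_desc, coprod.inl_desc_assoc, FreeObj.η_map]
  · rw [coprod.inr_map_assoc, fold, fold, coprod.inr_desc, coprod.inr_desc_assoc,
      FreeObj.str₀_map]

theorem FreeObj.map_comp {A C D : BddDistLat.{u}} (f : A ⟶ C) (g : C ⟶ D) :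
    FreeObj.map (ar₀ := ar₀) (ar₁ := ar₁) (f ≫ g) = FreeObj.map f ≫ FreeObj.map g :=
  (freeFunctor ar₀ ar₁).map_comp f g

theorem depthAlg₀_naturality {A C : BddDistLat.{u}} (f : A ⟶ C) :
    depthAlg₀ A ≫ unfObjMap f =
      (opFunctor ar₀).map (unfObjMap f) ≫ depthAlg₀ (ar₀ := ar₀) (ar₁ := ar₁) C := by
  simp only [depthAlg₀, Category.assoc, coprod.inr_map, ← Functor.map_comp_assoc, fold_naturality]

theorem depthAlg₁_naturality {A C : BddDistLat.{u}} (f : A ⟶ C) :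
    depthAlg₁ unf A ≫ unfObjMap f = (opFunctor ar₁).map (unfObjMap f) ≫ depthAlg₁ unf C := by
  simp only [depthAlg₁]
  rw [← Category.assoc ((opFunctor ar₁).map (unfObjMap f)), unfApp_naturality]
  simp only [Category.assoc]
  congr 1
  apply coprod.hom_ext
  · simp only [coprod.inl_map_assoc, coprod.inl_desc, coprod.inl_desc_assoc, Category.id_comp,
      Category.comp_id]
  · have h : FreeObj.map (ar₀ := ar₀) (ar₁ := ar₁) (unfObjMap f) ≫ FreeObj.map (fold C) =
        FreeObj.map (fold A) ≫ FreeObj.map (FreeObj.map (ar₀ := ar₀) (ar₁ := ar₁) f) := by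
      rw [← FreeObj.map_comp, fold_naturality, FreeObj.map_comp]
    simp only [coprod.inr_map_assoc, coprod.inr_desc, coprod.inr_desc_assoc,
      coprod.inr_map, ← Functor.map_comp_assoc]
    rw [← Category.assoc (FreeObj.map (unfObjMap f)), h, Category.assoc, FreeObj.mul_naturality]

/-- The unfolding of arbitrary terms: the `(L0 + L)`-algebra morphism `T A ⟶ A + L0 T A` that
extends the coproduct injection of `A`. -/
noncomputable def unfStarApp (A : BddDistLat.{u}) : FreeObj ar₀ ar₁ A ⟶ unfObj ar₀ ar₁ A :=
  FreeObj.lift coprod.inl (depthAlg₀ A) (depthAlg₁ unf A)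

/-- The natural transformation `T ⟶ id + L0 T` induced by `unf : L ⟶ id + L0 T`. -/
noncomputable def unfStar :
    freeFunctor.{u} ar₀ ar₁ ⟶ idPlus (freeFunctor ar₀ ar₁ ⋙ opFunctor ar₀) where
  app A := unfStarApp unf A
  naturality A C f := by
    change FreeObj.map f ≫ unfStarApp unf C = unfStarApp unf A ≫ unfObjMap f
    refine FreeObj.lift_unique (l₀ := depthAlg₀ C) (l₁ := depthAlg₁ unf C) ?_ ?_ ?_ ?_ ?_
    · simp [unfStarApp, reassoc_of% FreeObj.η_map, FreeObj.η_lift, reassoc_of% FreeObj.η_lift]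
    · simp only [unfStarApp, reassoc_of% FreeObj.str₀_map, FreeObj.str₀_lift, Functor.map_comp,
        Category.assoc]
    · simp only [unfStarApp, reassoc_of% FreeObj.str₀_lift, depthAlg₀_naturality, Functor.map_comp,
        Category.assoc]
    · simp only [unfStarApp, reassoc_of% FreeObj.str₁_map, FreeObj.str₁_lift, Functor.map_comp,
        Category.assoc]
    · simp only [unfStarApp, reassoc_of% FreeObj.str₁_lift, depthAlg₁_naturality, Functor.map_comp,
        Category.assoc]

end Depth

/-! ### Fixpoint schemes and formulas -/

section Schemes

mutual
/-- Positive fixpoint schemes without greatest fixpoints, over a modal similarity type `Λ` with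
arities `ar`: `Scheme V ar s` is the type of the schemes whose parametric variables belong to the
finite set `s`. In `sharp γ δ`, the scheme `γ` has parametric variables in `t`, and `δ` is the
substitution that assigns to each of the variables in `t` a scheme. -/
inductive Scheme (V : Type) {Λ : Type} (ar : Λ → ℕ) : Finset V → Type
  | var {s : Finset V} (v : s) : Scheme V ar s
  | fix {s : Finset V} : Scheme V ar s
  | form {s : Finset V} (φ : Formula V ar) : Scheme V ar s
  | or {s : Finset V} (γ δ : Scheme V ar s) : Scheme V ar s
  | and {s : Finset V} (γ δ : Scheme V ar s) : Scheme V ar s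
  | modal {s : Finset V} (m : Λ) (γ : Fin (ar m) → Scheme V ar s) : Scheme V ar s
  | sharp {s t : Finset V} (γ : Scheme V ar t) (δ : t → Scheme V ar s) : Scheme V ar s
/-- Positive formulas without greatest fixpoints. -/
inductive Formula (V : Type) {Λ : Type} (ar : Λ → ℕ) : Type
  | top : Formula V ar
  | bot : Formula V ar
  | or (φ ψ : Formula V ar) : Formula V ar
  | and (φ ψ : Formula V ar) : Formula V ar
  | modal (m : Λ) (φ : Fin (ar m) → Formula V ar) : Formula V ar
  | sharp {t : Finset V} (γ : Scheme V ar t) (φ : t → Formula V ar) : Formula V ar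
end

variable {V Λ : Type} {ar : Λ → ℕ}

/-- Guarded fixpoint schemes: combinations by `∨` and `∧` of parametric variables and modalities
applied to arbitrary schemes. -/
def Scheme.Guarded {s : Finset V} : Scheme V ar s → Prop
  | .var _ => True
  | .fix => False
  | .form _ => False
  | .or γ δ => γ.Guarded ∧ δ.Guarded
  | .and γ δ => γ.Guarded ∧ δ.Guarded
  | .modal _ _ => True
  | .sharp _ _ => False

mutual
/-- Every fixpoint modality that occurs in the scheme, at any depth, is of the form `♯_γ` with
`γ` guarded. -/
def Scheme.AllGuarded {s : Finset V} : Scheme V ar s → Prop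
  | .var _ => True
  | .fix => True
  | .form φ => φ.AllGuarded
  | .or γ δ => γ.AllGuarded ∧ δ.AllGuarded
  | .and γ δ => γ.AllGuarded ∧ δ.AllGuarded
  | .modal _ γ => ∀ i, (γ i).AllGuarded
  | .sharp γ δ => γ.Guarded ∧ γ.AllGuarded ∧ ∀ i, (δ i).AllGuarded
/-- Every fixpoint modality that occurs in the formula, at any depth, is of the form `♯_γ` with
`γ` guarded. -/
def Formula.AllGuarded : Formula V ar → Prop
  | .top => True
  | .bot => True
  | .or φ ψ => φ.AllGuarded ∧ ψ.AllGuarded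
  | .and φ ψ => φ.AllGuarded ∧ ψ.AllGuarded
  | .modal _ φ => ∀ i, (φ i).AllGuarded
  | .sharp γ φ => γ.Guarded ∧ γ.AllGuarded ∧ ∀ i, (φ i).AllGuarded
end

variable (V ar) in
/-- The fixpoint modalities `♯_γ` of the logic: the guarded fixpoint schemes `γ`, all of whose own
fixpoint modalities are of this kind. -/
structure FixMod where
  vars : Finset V
  body : Scheme V ar vars
  guarded : body.Guarded
  allGuarded : body.AllGuarded

variable (ar) in
/-- The modality `m` has `ar m` arguments. -/
def modArity (m : Λ) : Type := Fin (ar m)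

variable (V ar) in
/-- The modality `♯_γ` has one argument for each of the parametric variables of `γ`. -/
def fixArity (γ : FixMod V ar) : Type := γ.vars

variable (V ar) in
/-- `L0 A = Free {♥(a₁, …, aₙ)} / ≈`. -/
def L0 : BddDistLat.{u} ⥤ BddDistLat.{u} := opFunctor (modArity ar)

variable (V ar) in
/-- `L A = Free {♯_γ(a/v) | γ guarded} / ≈`. -/
def LFix : BddDistLat.{u} ⥤ BddDistLat.{u} := opFunctor (fixArity V ar)

variable (V ar) in
/-- The lattice `T A` of `(L0 + L)`-terms over `A`. -/
abbrev TObj (A : BddDistLat.{u}) : BddDistLat.{u} := FreeObj (modArity ar) (fixArity V ar) A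

variable (V ar) in
/-- The algebraically free monad `T` on `L0 + L` (its underlying functor). -/
noncomputable abbrev TFunctor : BddDistLat.{u} ⥤ BddDistLat.{u} :=
  freeFunctor (modArity ar) (fixArity V ar)

/-- The term `♥(a₁, …, aₙ)`. -/
noncomputable def TObj.modal {A : BddDistLat.{u}} (m : Λ) (a : Fin (ar m) → TObj V ar A) :
    TObj V ar A := FreeObj.op (modArity ar) (fixArity V ar) A (.inl m) a

/-- The term `♯_γ(a/v)`. -/
noncomputable def TObj.sharp {A : BddDistLat.{u}} (γ : FixMod V ar) (a : γ.vars → TObj V ar A) :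
    TObj V ar A := FreeObj.op (modArity ar) (fixArity V ar) A (.inr γ) a

theorem TObj.modal_mono {A : BddDistLat.{u}} (m : Λ) :
    Monotone (TObj.modal (V := V) (ar := ar) (A := A) m) :=
  FreeObj.op_mono (modArity ar) (fixArity V ar) A (.inl m)

theorem TObj.sharp_mono {A : BddDistLat.{u}} (γ : FixMod V ar) :
    Monotone (TObj.sharp (A := A) γ) :=
  FreeObj.op_mono (modArity ar) (fixArity V ar) A (.inr γ)

theorem TObj.map_modal {A C : BddDistLat.{u}} (f : A ⟶ C) (m : Λ)
    (a : Fin (ar m) → TObj V ar A) :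
    FreeObj.map f (TObj.modal m a) = TObj.modal m fun i => FreeObj.map f (a i) :=
  FreeObj.map_op (modArity ar) (fixArity V ar) f (.inl m) a

theorem TObj.map_sharp {A C : BddDistLat.{u}} (f : A ⟶ C) (γ : FixMod V ar)
    (a : γ.vars → TObj V ar A) :
    FreeObj.map f (TObj.sharp γ a) = TObj.sharp γ fun i => FreeObj.map f (a i) :=
  FreeObj.map_op (modArity ar) (fixArity V ar) f (.inr γ) a

variable (V ar) in
/-- The first injection into `A + L0 T A`. -/
noncomputable def unfInl (A : BddDistLat.{u}) : A ⟶ unfObj (modArity ar) (fixArity V ar) A :=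
  coprod.inl

variable (V ar) in
/-- The second injection into `A + L0 T A`. -/
noncomputable def unfInr (A : BddDistLat.{u}) :
    (L0 ar).obj (TObj V ar A) ⟶ unfObj (modArity ar) (fixArity V ar) A :=
  coprod.inr

/-- The generator `♥(a₁, …, aₙ)` of `L0 A`. -/
def modalGen {A : BddDistLat.{u}} (m : Λ) (a : Fin (ar m) → A) : (L0 ar).obj A :=
  opGen (modArity ar) m a

theorem modalGen_mono {A : BddDistLat.{u}} (m : Λ) :
    Monotone (modalGen (ar := ar) (A := A) m) := opGen_mono (modArity ar) m

mutual
/-- A fixpoint scheme, read as an `(L0 + L)`-term, with terms `p` substituted for the parametric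
variables and a term `ξ` for the fixpoint variable. -/
noncomputable def Scheme.toT {A : BddDistLat.{u}} {s : Finset V} :
    (γ : Scheme V ar s) → γ.AllGuarded → (s → TObj V ar A) → TObj V ar A → TObj V ar A
  | .var v, _, p, _ => p v
  | .fix, _, _, ξ => ξ
  | .form φ, h, _, _ => φ.toT h
  | .or γ δ, h, p, ξ => γ.toT h.1 p ξ ⊔ δ.toT h.2 p ξ
  | .and γ δ, h, p, ξ => γ.toT h.1 p ξ ⊓ δ.toT h.2 p ξ
  | .modal m γ, h, p, ξ => TObj.modal m fun i => (γ i).toT (h i) p ξ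
  | .sharp γ δ, h, p, ξ => TObj.sharp ⟨_, γ, h.1, h.2.1⟩ fun i => (δ i).toT (h.2.2 i) p ξ
/-- A formula, read as a closed `(L0 + L)`-term. -/
noncomputable def Formula.toT {A : BddDistLat.{u}} :
    (φ : Formula V ar) → φ.AllGuarded → TObj V ar A
  | .top, _ => ⊤
  | .bot, _ => ⊥
  | .or φ ψ, h => φ.toT h.1 ⊔ ψ.toT h.2
  | .and φ ψ, h => φ.toT h.1 ⊓ ψ.toT h.2
  | .modal m φ, h => TObj.modal m fun i => (φ i).toT (h i)
  | .sharp γ φ, h => TObj.sharp ⟨_, γ, h.1, h.2.1⟩ fun i => (φ i).toT (h.2.2 i)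
end

/-- A guarded fixpoint scheme, as an element of `A + L0 T A`, with elements `p` of `A` substituted
for the parametric variables and a term `ξ` for the fixpoint variable: parametric variables at the
top level go into `A`, modalities at the top level go into `L0 T A`. -/
noncomputable def Scheme.unfold {A : BddDistLat.{u}} {s : Finset V} :
    (γ : Scheme V ar s) → γ.Guarded → γ.AllGuarded → (s → A) → TObj V ar A →
      unfObj (modArity ar) (fixArity V ar) A
  | .var v, _, _, p, _ => unfInl V ar A (p v)
  | .fix, hg, _, _, _ => hg.elim
  | .form _, hg, _, _, _ => hg.elim
  | .or γ δ, hg, h, p, ξ => γ.unfold hg.1 h.1 p ξ ⊔ δ.unfold hg.2 h.2 p ξ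
  | .and γ δ, hg, h, p, ξ => γ.unfold hg.1 h.1 p ξ ⊓ δ.unfold hg.2 h.2 p ξ
  | .modal m γ, _, h, p, ξ =>
      unfInr V ar A (modalGen m fun i =>
        (γ i).toT (h i) (fun v => FreeObj.η (modArity ar) (fixArity V ar) A (p v)) ξ)
  | .sharp _ _, hg, _, _, _ => hg.elim

theorem Scheme.toT_mono {A : BddDistLat.{u}} {s : Finset V} :
    (γ : Scheme V ar s) → (h : γ.AllGuarded) → {p q : s → TObj V ar A} → {ξ ζ : TObj V ar A} →
      (∀ v, p v ≤ q v) → ξ ≤ ζ → γ.toT h p ξ ≤ γ.toT h q ζ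
  | .var v, _, _, _, _, _, hp, _ => hp v
  | .fix, _, _, _, _, _, _, hξ => hξ
  | .form _, _, _, _, _, _, _, _ => le_rfl
  | .or γ δ, h, _, _, _, _, hp, hξ => sup_le_sup (γ.toT_mono h.1 hp hξ) (δ.toT_mono h.2 hp hξ)
  | .and γ δ, h, _, _, _, _, hp, hξ => inf_le_inf (γ.toT_mono h.1 hp hξ) (δ.toT_mono h.2 hp hξ)
  | .modal m γ, h, _, _, _, _, hp, hξ =>
      TObj.modal_mono m fun i => (γ i).toT_mono (h i) hp hξ
  | .sharp _ δ, h, _, _, _, _, hp, hξ =>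
      TObj.sharp_mono _ fun i => (δ i).toT_mono (h.2.2 i) hp hξ

mutual
theorem Scheme.map_toT {A C : BddDistLat.{u}} (f : A ⟶ C) {s : Finset V} :
    (γ : Scheme V ar s) → (h : γ.AllGuarded) → (p : s → TObj V ar A) → (ξ : TObj V ar A) →
      FreeObj.map f (γ.toT h p ξ) = γ.toT h (fun v => FreeObj.map f (p v)) (FreeObj.map f ξ)
  | .var _, _, _, _ => rfl
  | .fix, _, _, _ => rfl
  | .form φ, h, _, _ => φ.map_toT f h
  | .or γ δ, h, p, ξ => (map_sup (FreeObj.map f).hom _ _).trans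
      (congrArg₂ (· ⊔ ·) (γ.map_toT f h.1 p ξ) (δ.map_toT f h.2 p ξ))
  | .and γ δ, h, p, ξ => (map_inf (FreeObj.map f).hom _ _).trans
      (congrArg₂ (· ⊓ ·) (γ.map_toT f h.1 p ξ) (δ.map_toT f h.2 p ξ))
  | .modal m γ, h, p, ξ => (TObj.map_modal f m _).trans
      (congrArg _ (funext fun i => (γ i).map_toT f (h i) p ξ))
  | .sharp γ δ, h, p, ξ => (TObj.map_sharp f ⟨_, γ, h.1, h.2.1⟩ _).trans
      (congrArg _ (funext fun i => (δ i).map_toT f (h.2.2 i) p ξ))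
theorem Formula.map_toT {A C : BddDistLat.{u}} (f : A ⟶ C) :
    (φ : Formula V ar) → (h : φ.AllGuarded) →
      FreeObj.map f (φ.toT (A := A) h) = φ.toT (A := C) h
  | .top, _ => map_top (FreeObj.map f).hom
  | .bot, _ => map_bot (FreeObj.map f).hom
  | .or φ ψ, h => (map_sup (FreeObj.map f).hom _ _).trans
      (congrArg₂ (· ⊔ ·) (φ.map_toT f h.1) (ψ.map_toT f h.2))
  | .and φ ψ, h => (map_inf (FreeObj.map f).hom _ _).trans
      (congrArg₂ (· ⊓ ·) (φ.map_toT f h.1) (ψ.map_toT f h.2))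
  | .modal m φ, h => (TObj.map_modal f m _).trans
      (congrArg _ (funext fun i => (φ i).map_toT f (h i)))
  | .sharp γ φ, h => (TObj.map_sharp f ⟨_, γ, h.1, h.2.1⟩ _).trans
      (congrArg _ (funext fun i => (φ i).map_toT f (h.2.2 i)))
end

theorem Scheme.unfold_mono {A : BddDistLat.{u}} {s : Finset V} :
    (γ : Scheme V ar s) → (hg : γ.Guarded) → (h : γ.AllGuarded) → {p q : s → A} →
      {ξ ζ : TObj V ar A} → (∀ v, p v ≤ q v) → ξ ≤ ζ → γ.unfold hg h p ξ ≤ γ.unfold hg h q ζ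
  | .var v, _, _, _, _, _, _, hp, _ => OrderHomClass.mono (unfInl V ar A).hom (hp v)
  | .fix, hg, _, _, _, _, _, _, _ => hg.elim
  | .form _, hg, _, _, _, _, _, _, _ => hg.elim
  | .or γ δ, hg, h, _, _, _, _, hp, hξ =>
      sup_le_sup (γ.unfold_mono hg.1 h.1 hp hξ) (δ.unfold_mono hg.2 h.2 hp hξ)
  | .and γ δ, hg, h, _, _, _, _, hp, hξ =>
      inf_le_inf (γ.unfold_mono hg.1 h.1 hp hξ) (δ.unfold_mono hg.2 h.2 hp hξ)
  | .modal m γ, _, h, _, _, _, _, hp, hξ =>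
      OrderHomClass.mono (unfInr V ar A).hom (modalGen_mono m fun i =>
        (γ i).toT_mono (h i)
          (fun v => OrderHomClass.mono (FreeObj.η (modArity ar) (fixArity V ar) A).hom (hp v)) hξ)
  | .sharp _ _, hg, _, _, _, _, _, _, _ => hg.elim

theorem Scheme.map_unfold {A C : BddDistLat.{u}} (f : A ⟶ C) {s : Finset V} :
    (γ : Scheme V ar s) → (hg : γ.Guarded) → (h : γ.AllGuarded) → (p : s → A) →
      (ξ : TObj V ar A) →
      unfObjMap f (γ.unfold hg h p ξ) = γ.unfold hg h (fun v => f (p v)) (FreeObj.map f ξ)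
  | .var v, _, _, p, _ => ConcreteCategory.congr_hom (coprod.inl_map f _) (p v)
  | .fix, hg, _, _, _ => hg.elim
  | .form _, hg, _, _, _ => hg.elim
  | .or γ δ, hg, h, p, ξ => (map_sup (unfObjMap f).hom _ _).trans
      (congrArg₂ (· ⊔ ·) (γ.map_unfold f hg.1 h.1 p ξ) (δ.map_unfold f hg.2 h.2 p ξ))
  | .and γ δ, hg, h, p, ξ => (map_inf (unfObjMap f).hom _ _).trans
      (congrArg₂ (· ⊓ ·) (γ.map_unfold f hg.1 h.1 p ξ) (δ.map_unfold f hg.2 h.2 p ξ))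
  | .modal m γ, _, h, _, ξ =>
      (ConcreteCategory.congr_hom (coprod.inr_map f _) _).trans
        (congrArg (fun a => unfInr V ar C (modalGen m a))
          (funext fun i => (γ i).map_toT f (h i) _ ξ))
  | .sharp _ _, hg, _, _, _ => hg.elim

variable (V ar) in
/-- The component at `A` of the unfolding of fixpoint modalities,
`♯_γ(a/v) ↦ γ(a/v, ♯_γ(a/v)/x)`, with values in `A + L0 T A`. -/
noncomputable def unfFixApp (A : BddDistLat.{u}) :
    (LFix V ar).obj A ⟶ unfObj (modArity ar) (fixArity V ar) A :=
  opLift (fixArity V ar)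
    (fun γ a => γ.body.unfold γ.guarded γ.allGuarded a
      (TObj.sharp γ fun v => FreeObj.η (modArity ar) (fixArity V ar) A (a v)))
    (fun γ _ _ hab => γ.body.unfold_mono γ.guarded γ.allGuarded hab
      (TObj.sharp_mono γ fun v =>
        OrderHomClass.mono (FreeObj.η (modArity ar) (fixArity V ar) A).hom (hab v)))

variable (V ar) in
/-- The unfolding of fixpoint modalities, `unf : L ⟶ id + L0 T`. -/
noncomputable def unfFix : LFix.{u} V ar ⟶ idPlus (TFunctor V ar ⋙ L0 ar) where
  app A := unfFixApp V ar A
  naturality A C f := by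
    refine op_hom_ext fun γ a => ?_
    refine Eq.trans ?_ (γ.body.map_unfold f γ.guarded γ.allGuarded a _).symm
    refine congrArg (γ.body.unfold γ.guarded γ.allGuarded fun v => f (a v)) ?_
    exact (TObj.map_sharp f γ fun v => FreeObj.η (modArity ar) (fixArity V ar) A (a v)).symm

end Schemes

/-! ### Predicate liftings and the one-step semantics -/

/-- A monotone predicate lifting `P^n ⟶ P B`. -/
structure PredLifting (B : Type u ⥤ Type u) (n : ℕ) where
  app (X : Type u) : (Fin n → Set X) → Set (B.obj X)
  naturality {X Y : Type u} (f : X ⟶ Y) (U : Fin n → Set Y) :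
    app X (fun i => f ⁻¹' U i) = B.map f ⁻¹' app Y U
  monotone (X : Type u) : Monotone (app X)

section Semantics

variable {V Λ : Type} {ar : Λ → ℕ} {B : Type u ⥤ Type u}
  (lift : (m : Λ) → PredLifting B (ar m))

/-- The one-step semantics `δ : L0 P ⟶ P B`, `♥(U₁, …, Uₙ) ↦ ⟦♥⟧(U₁, …, Uₙ)`. -/
def oneStep : Pow.{u} ⋙ L0 ar ⟶ B.op ⋙ Pow where
  app X := opLift (modArity ar) (C := Pow.obj (B.op.obj X)) (fun m U => (lift m).app X.unop U)
    (fun m => (lift m).monotone X.unop)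
  naturality _ _ f := op_hom_ext fun m U => (lift m).naturality f.unop U

variable (V) in
/-- The unfolding system of the positive logic of least fixpoints: the one-step logic `(L0, δ)`
with the unfolding `T ⟶ id + L0 T`. -/
noncomputable def cflSystem : UnfoldingSystem.{u} B where
  L0 := L0 ar
  L := TFunctor V ar
  L0_enriched := opFunctor_enriched _
  L_enriched := freeFunctor_enriched _ _
  hasInitial := freeFunctor_hasInitial _ _
  δ := oneStep lift
  unf := unfStar (unfFix V ar)

/-! ### The set-theoretic semantics -/

/-- The least fixpoint of a monotone operator on the powerset of `X`, as the intersection of its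
prefixed points. -/
def lfpSet {X : Type u} (F : Set X → Set X) : Set X := ⋂₀ {U | F U ⊆ U}

theorem lfpSet_isLeast {X : Type u} {F : Set X → Set X} (hF : Monotone F) :
    IsLeast {U | F U = U} (lfpSet F) :=
  OrderHom.isLeast_lfp (α := Set X) ⟨F, hF⟩

variable {X : Type u} (σ : X ⟶ B.obj X)

mutual
/-- The semantics of a fixpoint scheme, given a valuation `p` of the parametric variables and a
value `ξ` of the fixpoint variable. -/
def Scheme.sem {s : Finset V} : Scheme V ar s → (s → Set X) → Set X → Set X
  | .var v, p, _ => p v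
  | .fix, _, ξ => ξ
  | .form φ, _, _ => φ.sem
  | .or γ δ, p, ξ => γ.sem p ξ ∪ δ.sem p ξ
  | .and γ δ, p, ξ => γ.sem p ξ ∩ δ.sem p ξ
  | .modal m γ, p, ξ => σ ⁻¹' (lift m).app X fun i => (γ i).sem p ξ
  | .sharp γ δ, p, ξ => lfpSet fun U => γ.sem (fun v => (δ v).sem p ξ) U
/-- The semantics of a formula. -/
def Formula.sem : Formula V ar → Set X
  | .top => Set.univ
  | .bot => ∅
  | .or φ ψ => φ.sem ∪ ψ.sem
  | .and φ ψ => φ.sem ∩ ψ.sem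
  | .modal m φ => σ ⁻¹' (lift m).app X fun i => (φ i).sem
  | .sharp γ φ => lfpSet fun U => γ.sem (fun v => (φ v).sem) U
end

/-- The semantics of schemes is monotone, so that all the fixpoints above exist. -/
theorem Scheme.sem_mono {s : Finset V} : (γ : Scheme V ar s) → {p q : s → Set X} →
    {ξ ζ : Set X} → (∀ v, p v ⊆ q v) → ξ ⊆ ζ → γ.sem lift σ p ξ ⊆ γ.sem lift σ q ζ
  | .var v, _, _, _, _, hp, _ => hp v
  | .fix, _, _, _, _, _, hξ => hξ
  | .form _, _, _, _, _, _, _ => subset_rfl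
  | .or γ δ, _, _, _, _, hp, hξ => Set.union_subset_union (γ.sem_mono hp hξ) (δ.sem_mono hp hξ)
  | .and γ δ, _, _, _, _, hp, hξ => Set.inter_subset_inter (γ.sem_mono hp hξ) (δ.sem_mono hp hξ)
  | .modal m γ, _, _, _, _, hp, hξ =>
      Set.preimage_mono ((lift m).monotone X fun i => (γ i).sem_mono hp hξ)
  | .sharp γ δ, _, _, _, _, hp, hξ => Set.sInter_subset_sInter fun _ hU =>
      (γ.sem_mono (fun v => (δ v).sem_mono hp hξ) subset_rfl).trans hU

theorem Scheme.sem_sharp_isLeast {s t : Finset V} (γ : Scheme V ar t) (δ : t → Scheme V ar s)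
    (p : s → Set X) (ξ : Set X) :
    IsLeast {U | γ.sem lift σ (fun v => (δ v).sem lift σ p ξ) U = U}
      ((Scheme.sharp γ δ).sem lift σ p ξ) :=
  lfpSet_isLeast fun _ _ h => γ.sem_mono lift σ (fun _ => subset_rfl) h

theorem Formula.sem_sharp_isLeast {t : Finset V} (γ : Scheme V ar t) (φ : t → Formula V ar) :
    IsLeast {U | γ.sem lift σ (fun v => (φ v).sem lift σ) U = U}
      ((Formula.sharp γ φ).sem lift σ) :=
  lfpSet_isLeast fun _ _ h => γ.sem_mono lift σ (fun _ => subset_rfl) h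

end Semantics

/-! ### Formulas as elements of the initial algebra -/

section Formulas

variable {V Λ : Type} {ar : Λ → ℕ}

/-- The element of a `T`-algebra that a formula denotes. -/
noncomputable def Formula.toAlg (Φ : Endofunctor.Algebra (TFunctor.{u} V ar)) (φ : Formula V ar)
    (h : φ.AllGuarded) : Φ.a := Φ.str (φ.toT (A := Φ.a) h)

/-- The bounded distributive lattice without generators and relations, that is, the initial one. -/
def zeroLat : BddDistLat.{u} := Pres (G := PEmpty.{u + 1}) (ar := noOps) fun _ _ => False

variable (V ar) in
/-- The lattice `T 0` of closed `(L0 + L)`-terms, that is, of formulas up to `≈`, as a `T`-algebra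
under the multiplication of the monad `T`. -/
noncomputable def formulaAlg : Endofunctor.Algebra (TFunctor.{u} V ar) where
  a := TObj V ar zeroLat
  str := FreeObj.mul (modArity ar) (fixArity V ar) zeroLat

/-- The map from the initial `T`-algebra to formulas up to `≈` that forgets how a formula is
bracketed into layers of terms. -/
noncomputable def flatten {Φ : Endofunctor.Algebra (TFunctor.{u} V ar)} (hΦ : IsInitial Φ) :
    Φ.a ⟶ TObj V ar zeroLat := (hΦ.to (formulaAlg V ar)).f

/-- The formula `φ` represents the element `a` of the initial `T`-algebra. -/
def Represents {Φ : Endofunctor.Algebra (TFunctor.{u} V ar)} (hΦ : IsInitial Φ)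
    (φ : Formula V ar) (a : Φ.a) : Prop :=
  ∃ h : φ.AllGuarded, flatten hΦ a = φ.toT h

end Formulas

end CFL

namespace CFL

section Algebra

variable {O₀ O₁ : Type} {ar₀ : O₀ → Type} {ar₁ : O₁ → Type}

/-- The full unfolding `T A ⟶ A + L0 T A ⟶ T A`. -/
noncomputable def unfoldTerm
    (unf : opFunctor.{u} ar₁ ⟶ idPlus (freeFunctor ar₀ ar₁ ⋙ opFunctor ar₀)) (A : BddDistLat.{u}) :
    FreeObj ar₀ ar₁ A ⟶ FreeObj ar₀ ar₁ A := unfStarApp unf A ≫ fold A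

/-- The morphism `T f ≫ mult` of free algebras extending `f : C ⟶ T A`. -/
noncomputable def FreeObj.bind {A C : BddDistLat.{u}} (f : C ⟶ FreeObj ar₀ ar₁ A) :
    FreeObj ar₀ ar₁ C ⟶ FreeObj ar₀ ar₁ A :=
  FreeObj.lift f (FreeObj.str₀ ar₀ ar₁ A) (FreeObj.str₁ ar₀ ar₁ A)

theorem FreeObj.bind_op {A C : BddDistLat.{u}} (f : C ⟶ FreeObj ar₀ ar₁ A) (o : O₀ ⊕ O₁)
    (a : arity ar₀ ar₁ o → FreeObj ar₀ ar₁ C) :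
    FreeObj.bind f (FreeObj.op ar₀ ar₁ C o a) =
      FreeObj.op ar₀ ar₁ A o (fun i => FreeObj.bind f (a i)) := by
  refine (FreeObj.lift_op _ _ _ o a).trans ?_
  cases o <;> rfl

theorem FreeObj.map_lift {A C D : BddDistLat.{u}} (g : A ⟶ C) (f : C ⟶ D)
    (l₀ : (opFunctor ar₀).obj D ⟶ D) (l₁ : (opFunctor ar₁).obj D ⟶ D) :
    FreeObj.map g ≫ FreeObj.lift f l₀ l₁ = FreeObj.lift (g ≫ f) l₀ l₁ := by
  refine FreeObj.hom_ext ar₀ ar₁ (fun a => rfl) (fun o a h => ?_)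
  rw [BddDistLat.comp_apply, FreeObj.map_op, FreeObj.lift_op, FreeObj.lift_op]
  exact congrArg _ (funext h)

theorem FreeObj.mul_lift {A D : BddDistLat.{u}} (f : A ⟶ D)
    (l₀ : (opFunctor ar₀).obj D ⟶ D) (l₁ : (opFunctor ar₁).obj D ⟶ D) :
    FreeObj.mul ar₀ ar₁ A ≫ FreeObj.lift f l₀ l₁ =
      FreeObj.lift (FreeObj.lift f l₀ l₁) l₀ l₁ := by
  refine FreeObj.hom_ext ar₀ ar₁ (fun a => rfl) (fun o a h => ?_)
  rw [BddDistLat.comp_apply, FreeObj.lift_op]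
  refine (congrArg (FreeObj.lift f l₀ l₁) (FreeObj.bind_op (𝟙 _) o a)).trans ?_
  rw [FreeObj.lift_op]
  exact congrArg _ (funext h)

theorem FreeObj.map_mul {A C : BddDistLat.{u}} (f : C ⟶ FreeObj ar₀ ar₁ A) :
    FreeObj.map f ≫ FreeObj.mul ar₀ ar₁ A = FreeObj.bind f :=
  FreeObj.map_lift f (𝟙 _) _ _

/-- A map `t : A ⟶ D` and a map `y : T A ⟶ D` into an `L0`-algebra `D` yield a map
`A + L0 T A ⟶ D`. -/
noncomputable def stepDesc {A D : BddDistLat.{u}} (l₀ : (opFunctor ar₀).obj D ⟶ D) (t : A ⟶ D)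
    (y : FreeObj ar₀ ar₁ A ⟶ D) : unfObj ar₀ ar₁ A ⟶ D :=
  coprod.desc t ((opFunctor ar₀).map y ≫ l₀)

section
variable {A D : BddDistLat.{u}} (l₀ : (opFunctor ar₀).obj D ⟶ D) (t : A ⟶ D)
    (y : FreeObj ar₀ ar₁ A ⟶ D)

theorem inl_stepDesc : coprod.inl ≫ stepDesc l₀ t y = t := coprod.inl_desc _ _

theorem inr_stepDesc : coprod.inr ≫ stepDesc l₀ t y = (opFunctor ar₀).map y ≫ l₀ :=
  coprod.inr_desc _ _

variable (unf : opFunctor.{u} ar₁ ⟶ idPlus (freeFunctor ar₀ ar₁ ⋙ opFunctor ar₀))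

theorem depthAlg₀_stepDesc :
    depthAlg₀ A ≫ stepDesc l₀ t y = (opFunctor ar₀).map (fold A ≫ y) ≫ l₀ := by
  rw [depthAlg₀, Category.assoc, inr_stepDesc, Functor.map_comp, Category.assoc]

theorem depthAlg₁_stepDesc :
    depthAlg₁ unf A ≫ stepDesc l₀ t y = unfApp unf (unfObj ar₀ ar₁ A) ≫
      stepDesc l₀ (stepDesc l₀ t y) (FreeObj.bind (fold A) ≫ y) := by
  simp only [depthAlg₁, Category.assoc]
  congr 1
  apply coprod.hom_ext
  · simp only [stepDesc, coprod.inl_map_assoc, coprod.inl_desc_assoc, coprod.inl_desc,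
      Category.id_comp]
  · simp only [stepDesc, coprod.inr_map_assoc, coprod.inr_desc_assoc, coprod.inr_desc,
      ← FreeObj.map_mul, Functor.map_comp, Category.assoc]

theorem str₀_unfStarApp_stepDesc :
    FreeObj.str₀ ar₀ ar₁ A ≫ unfStarApp unf A ≫ stepDesc l₀ t y =
      (opFunctor ar₀).map (unfStarApp unf A ≫ fold A ≫ y) ≫ l₀ := by
  rw [unfStarApp, reassoc_of% FreeObj.str₀_lift, depthAlg₀_stepDesc, ← Functor.map_comp_assoc]

theorem str₁_unfStarApp_stepDesc :
    FreeObj.str₁ ar₀ ar₁ A ≫ unfStarApp unf A ≫ stepDesc l₀ t y =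
      (opFunctor ar₁).map (unfStarApp unf A) ≫ unfApp unf (unfObj ar₀ ar₁ A) ≫
        stepDesc l₀ (stepDesc l₀ t y) (FreeObj.bind (fold A) ≫ y) := by
  rw [unfStarApp, reassoc_of% FreeObj.str₁_lift, depthAlg₁_stepDesc]

/-- The maps on terms that are compatible with unfolding and agree with `t` on generators. -/
def IsSolution : Prop := y = unfStarApp unf A ≫ stepDesc l₀ t y

variable {l₀ t y unf}

theorem IsSolution.η (h : IsSolution l₀ t y unf) : FreeObj.η ar₀ ar₁ A ≫ y = t := by
  rw [h, unfStarApp, reassoc_of% FreeObj.η_lift, inl_stepDesc]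

theorem IsSolution.str₀ (h : IsSolution l₀ t y unf) :
    FreeObj.str₀ ar₀ ar₁ A ≫ y = (opFunctor ar₀).map (unfoldTerm unf A ≫ y) ≫ l₀ := by
  conv_lhs => rw [h]
  rw [str₀_unfStarApp_stepDesc, unfoldTerm, Category.assoc]

theorem IsSolution.str₁ (h : IsSolution l₀ t y unf) :
    FreeObj.str₁ ar₀ ar₁ A ≫ y = (opFunctor ar₁).map (unfStarApp unf A) ≫
      unfApp unf (unfObj ar₀ ar₁ A) ≫
      stepDesc l₀ (stepDesc l₀ t y) (FreeObj.bind (fold A) ≫ y) := by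
  conv_lhs => rw [h]
  rw [str₁_unfStarApp_stepDesc]

theorem IsSolution.fold_comp (h : IsSolution l₀ t y unf) :
    fold A ≫ y = stepDesc l₀ t (unfoldTerm unf A ≫ y) := by
  apply coprod.hom_ext
  · rw [fold, coprod.inl_desc_assoc, h.η, inl_stepDesc]
  · rw [fold, coprod.inr_desc_assoc, inr_stepDesc, h.str₀]

theorem IsSolution.unfoldTerm_comp (h : IsSolution l₀ t y unf) :
    IsSolution l₀ t (unfoldTerm unf A ≫ y) unf :=
  (Category.assoc _ _ _).trans (congrArg (unfStarApp unf A ≫ ·) h.fold_comp)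

end

end Algebra

section Semantics

variable {V Λ : Type} {ar : Λ → ℕ} {B : Type u ⥤ Type u}
  (lift : (m : Λ) → PredLifting B (ar m)) {X : Type u} (σ : X ⟶ B.obj X)

/-- The interpretation of modalities on `P X`, as an `L0`-algebra. -/
def modalAlg : (opFunctor (modArity ar)).obj (Pow.obj (op X)) ⟶ Pow.obj (op X) :=
  (oneStep lift).app (op X) ≫ Pow.map σ.op

variable (V) in
/-- The interpretation of fixpoint modalities on `P X`, as an `L`-algebra. -/
def fixAlg : (opFunctor (fixArity V ar)).obj (Pow.obj (op X)) ⟶ Pow.obj (op X) :=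
  opLift (fixArity V ar) (C := Pow.obj (op X))
    (fun γ U => (lfpSet fun W => γ.body.sem lift σ U W : Set X))
    (fun γ _ _ h => Set.sInter_subset_sInter fun _ hW =>
      (γ.body.sem_mono lift σ h subset_rfl).trans hW)

variable {A : BddDistLat.{u}} (f : A ⟶ Pow.obj (op X))

/-- The interpretation of terms with generators interpreted by `f`. -/
def interp : TObj V ar A ⟶ Pow.obj (op X) :=
  FreeObj.lift f (modalAlg lift σ) (fixAlg V lift σ)

theorem interp_modal (m : Λ) (a : Fin (ar m) → TObj V ar A) :
    interp lift σ f (TObj.modal m a) =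
      (σ ⁻¹' (lift m).app X fun i => interp lift σ f (a i) : Set X) :=
  FreeObj.lift_op f (modalAlg lift σ) (fixAlg V lift σ) (.inl m) a

theorem interp_sharp (γ : FixMod V ar) (a : γ.vars → TObj V ar A) :
    interp lift σ f (TObj.sharp γ a) =
      (lfpSet fun W => γ.body.sem lift σ (fun i => interp lift σ f (a i)) W : Set X) :=
  FreeObj.lift_op f (modalAlg lift σ) (fixAlg V lift σ) (.inr γ) a

mutual
theorem Scheme.interp_toT {s : Finset V} : (γ : Scheme V ar s) → (h : γ.AllGuarded) →
    (p : s → TObj V ar A) → (ξ : TObj V ar A) →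
      interp lift σ f (γ.toT h p ξ) =
        γ.sem lift σ (fun v => interp lift σ f (p v)) (interp lift σ f ξ)
  | .var _, _, _, _ => rfl
  | .fix, _, _, _ => rfl
  | .form φ, h, _, _ => φ.interp_toT h
  | .or γ δ, h, p, ξ => (map_sup (interp lift σ f).hom _ _).trans
      (congrArg₂ (fun U W : Set X => U ∪ W) (γ.interp_toT h.1 p ξ) (δ.interp_toT h.2 p ξ))
  | .and γ δ, h, p, ξ => (map_inf (interp lift σ f).hom _ _).trans
      (congrArg₂ (fun U W : Set X => U ∩ W) (γ.interp_toT h.1 p ξ) (δ.interp_toT h.2 p ξ))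
  | .modal m γ, h, p, ξ => (interp_modal lift σ f m _).trans
      (congrArg (fun U => (σ ⁻¹' (lift m).app X U : Set X))
        (funext fun i => (γ i).interp_toT (h i) p ξ))
  | .sharp γ δ, h, p, ξ => (interp_sharp lift σ f ⟨_, γ, h.1, h.2.1⟩ _).trans
      (congrArg (fun U => (lfpSet fun W => γ.sem lift σ U W : Set X))
        (funext fun i => (δ i).interp_toT (h.2.2 i) p ξ))
theorem Formula.interp_toT : (φ : Formula V ar) → (h : φ.AllGuarded) →
      interp lift σ f (φ.toT h) = φ.sem lift σ
  | .top, _ => map_top (interp lift σ f).hom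
  | .bot, _ => map_bot (interp lift σ f).hom
  | .or φ ψ, h => (map_sup (interp lift σ f).hom _ _).trans
      (congrArg₂ (fun U W : Set X => U ∪ W) (φ.interp_toT h.1) (ψ.interp_toT h.2))
  | .and φ ψ, h => (map_inf (interp lift σ f).hom _ _).trans
      (congrArg₂ (fun U W : Set X => U ∩ W) (φ.interp_toT h.1) (ψ.interp_toT h.2))
  | .modal m φ, h => (interp_modal lift σ f m _).trans
      (congrArg (fun U => (σ ⁻¹' (lift m).app X U : Set X))
        (funext fun i => (φ i).interp_toT (h i)))
  | .sharp γ φ, h => (interp_sharp lift σ f ⟨_, γ, h.1, h.2.1⟩ _).trans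
      (congrArg (fun U => (lfpSet fun W => γ.sem lift σ U W : Set X))
        (funext fun i => (φ i).interp_toT (h.2.2 i)))
end

mutual
theorem Scheme.bind_toT {A C : BddDistLat.{u}} (f : A ⟶ TObj V ar C) {s : Finset V} :
    (γ : Scheme V ar s) → (h : γ.AllGuarded) → (p : s → TObj V ar A) → (ξ : TObj V ar A) →
      FreeObj.bind f (γ.toT h p ξ) = γ.toT h (fun v => FreeObj.bind f (p v)) (FreeObj.bind f ξ)
  | .var _, _, _, _ => rfl
  | .fix, _, _, _ => rfl
  | .form φ, h, _, _ => φ.bind_toT f h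
  | .or γ δ, h, p, ξ => (map_sup (FreeObj.bind f).hom _ _).trans
      (congrArg₂ (· ⊔ ·) (γ.bind_toT f h.1 p ξ) (δ.bind_toT f h.2 p ξ))
  | .and γ δ, h, p, ξ => (map_inf (FreeObj.bind f).hom _ _).trans
      (congrArg₂ (· ⊓ ·) (γ.bind_toT f h.1 p ξ) (δ.bind_toT f h.2 p ξ))
  | .modal m γ, h, p, ξ => (FreeObj.bind_op f (.inl m) _).trans
      (congrArg (TObj.modal m) (funext fun i => (γ i).bind_toT f (h i) p ξ))
  | .sharp γ δ, h, p, ξ => (FreeObj.bind_op f (.inr ⟨_, γ, h.1, h.2.1⟩) _).trans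
      (congrArg (TObj.sharp ⟨_, γ, h.1, h.2.1⟩) (funext fun i => (δ i).bind_toT f (h.2.2 i) p ξ))
theorem Formula.bind_toT {A C : BddDistLat.{u}} (f : A ⟶ TObj V ar C) :
    (φ : Formula V ar) → (h : φ.AllGuarded) →
      FreeObj.bind f (φ.toT (A := A) h) = φ.toT (A := C) h
  | .top, _ => map_top (FreeObj.bind f).hom
  | .bot, _ => map_bot (FreeObj.bind f).hom
  | .or φ ψ, h => (map_sup (FreeObj.bind f).hom _ _).trans
      (congrArg₂ (· ⊔ ·) (φ.bind_toT f h.1) (ψ.bind_toT f h.2))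
  | .and φ ψ, h => (map_inf (FreeObj.bind f).hom _ _).trans
      (congrArg₂ (· ⊓ ·) (φ.bind_toT f h.1) (ψ.bind_toT f h.2))
  | .modal m φ, h => (FreeObj.bind_op f (.inl m) _).trans
      (congrArg (TObj.modal m) (funext fun i => (φ i).bind_toT f (h i)))
  | .sharp γ φ, h => (FreeObj.bind_op f (.inr ⟨_, γ, h.1, h.2.1⟩) _).trans
      (congrArg (TObj.sharp ⟨_, γ, h.1, h.2.1⟩) (funext fun i => (φ i).bind_toT f (h.2.2 i)))
end

end Semantics

section Unfolding

variable {V Λ : Type} {ar : Λ → ℕ} {B : Type u ⥤ Type u}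
  (lift : (m : Λ) → PredLifting B (ar m)) {X : Type u} (σ : X ⟶ B.obj X)
  {A C : BddDistLat.{u}}

theorem Pow.hom_sup (g : A ⟶ Pow.obj (op X)) (a b : A) :
    @Eq (Set X) (g (a ⊔ b)) ((fun U W : Set X => U ∪ W) (g a) (g b)) := g.hom.map_sup' a b

theorem Pow.hom_inf (g : A ⟶ Pow.obj (op X)) (a b : A) :
    @Eq (Set X) (g (a ⊓ b)) ((fun U W : Set X => U ∩ W) (g a) (g b)) := g.hom.map_inf' a b

section
variable (d : C ⟶ Pow.obj (op X)) (y : TObj V ar C ⟶ Pow.obj (op X))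

theorem stepDesc_inl (a : C) : stepDesc (modalAlg lift σ) d y (unfInl V ar C a) = d a :=
  ConcreteCategory.congr_hom (inl_stepDesc (modalAlg lift σ) d y) a

theorem stepDesc_modal (m : Λ) (a : Fin (ar m) → TObj V ar C) :
    stepDesc (modalAlg lift σ) d y (unfInr V ar C (modalGen m a)) =
      (σ ⁻¹' (lift m).app X fun i => y (a i) : Set X) :=
  ConcreteCategory.congr_hom (inr_stepDesc (modalAlg lift σ) d y) (opGen (modArity ar) m a)

theorem Scheme.stepDesc_unfold {s : Finset V} : (γ : Scheme V ar s) → (hg : γ.Guarded) →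
    (h : γ.AllGuarded) → (p : s → C) → (ξ : TObj V ar C) →
      stepDesc (modalAlg lift σ) d (interp lift σ d) (γ.unfold hg h p ξ) =
        γ.sem lift σ (fun v => d (p v)) (interp lift σ d ξ)
  | .var v, _, _, p, _ => stepDesc_inl lift σ d _ (p v)
  | .fix, hg, _, _, _ => hg.elim
  | .form _, hg, _, _, _ => hg.elim
  | .or γ δ, hg, h, p, ξ => (map_sup (stepDesc (modalAlg lift σ) d (interp lift σ d)).hom _ _).trans
      (congrArg₂ (fun U W : Set X => U ∪ W) (γ.stepDesc_unfold hg.1 h.1 p ξ)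
        (δ.stepDesc_unfold hg.2 h.2 p ξ))
  | .and γ δ, hg, h, p, ξ =>
      (map_inf (stepDesc (modalAlg lift σ) d (interp lift σ d)).hom _ _).trans
      (congrArg₂ (fun U W : Set X => U ∩ W) (γ.stepDesc_unfold hg.1 h.1 p ξ)
        (δ.stepDesc_unfold hg.2 h.2 p ξ))
  | .modal m γ, _, h, _, ξ => (stepDesc_modal lift σ d _ m _).trans
      (congrArg (fun U => (σ ⁻¹' (lift m).app X U : Set X))
        (funext fun i => (γ i).interp_toT lift σ d (h i) _ ξ))
  | .sharp _ _, hg, _, _, _ => hg.elim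

end

theorem fold_interp (f : A ⟶ Pow.obj (op X)) :
    fold A ≫ interp lift σ f = stepDesc (modalAlg lift σ) f (interp (V := V) lift σ f) := by
  apply coprod.hom_ext
  · rw [fold, coprod.inl_desc_assoc, inl_stepDesc]
    rfl
  · rw [fold, coprod.inr_desc_assoc, inr_stepDesc]
    exact FreeObj.str₀_lift _ _ _

theorem bind_interp (f : A ⟶ Pow.obj (op X)) (g : C ⟶ TObj V ar A) :
    FreeObj.bind g ≫ interp lift σ f = interp lift σ (g ≫ interp lift σ f) := by
  rw [← FreeObj.map_mul, Category.assoc, interp, FreeObj.mul_lift, FreeObj.map_lift]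
  rfl

/-- Unfolding is sound for the set-theoretic interpretation of terms. -/
theorem isSolution_interp (f : A ⟶ Pow.obj (op X)) :
    IsSolution (modalAlg lift σ) f (interp lift σ f) (unfFix V ar) := by
  refine FreeObj.hom_ext (modArity ar) (fixArity V ar) (fun a => ?_) ?_
  · exact (stepDesc_inl lift σ f (interp (V := V) lift σ f) a).symm
  rintro (m | γ) a h
  · have e := str₀_unfStarApp_stepDesc (modalAlg lift σ) f (interp lift σ f) (unfFix V ar)
    rw [fold_interp] at e
    refine (interp_modal lift σ f m a).trans ?_
    refine Eq.trans ?_ (ConcreteCategory.congr_hom e (opGen (modArity ar) m a)).symm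
    exact congrArg (fun U => (σ ⁻¹' (lift m).app X U : Set X)) (funext h)
  · have e := str₁_unfStarApp_stepDesc (modalAlg lift σ) f (interp lift σ f) (unfFix V ar)
    rw [bind_interp, fold_interp] at e
    refine (interp_sharp lift σ f γ a).trans ?_
    refine Eq.trans ?_ (ConcreteCategory.congr_hom e (opGen (fixArity V ar) γ a)).symm
    refine Eq.trans ?_ (γ.body.stepDesc_unfold lift σ _ γ.guarded γ.allGuarded
      (fun v => unfStarApp (unfFix V ar) A (a v)) _).symm
    rw [interp_sharp]
    refine (congrArg (fun U => (lfpSet fun W => γ.body.sem lift σ U W : Set X)) (funext h)).trans ?_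
    exact (lfpSet_isLeast fun _ _ h => γ.body.sem_mono lift σ (fun _ => subset_rfl) h).1.symm

variable (t : A ⟶ Pow.obj (op X))

/-- The set `U` is contained in the value of the term `z` under every solution for `t`. -/
def Below (U : Set X) (z : TObj V ar A) : Prop :=
  ∀ y : TObj V ar A ⟶ Pow.obj (op X), IsSolution (modalAlg lift σ) t y (unfFix V ar) →
    U ⊆ (y z : Set X)

section
variable {lift σ t}

theorem Below.sup {U W : Set X} {z w : TObj V ar A} (hU : Below lift σ t U z)
    (hW : Below lift σ t W w) : Below lift σ t (U ∪ W) (z ⊔ w) := fun y hy =>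
  (Set.union_subset_union (hU y hy) (hW y hy)).trans (Pow.hom_sup y z w).ge

theorem Below.inf {U W : Set X} {z w : TObj V ar A} (hU : Below lift σ t U z)
    (hW : Below lift σ t W w) : Below lift σ t (U ∩ W) (z ⊓ w) := fun y hy =>
  (Set.inter_subset_inter (hU y hy) (hW y hy)).trans (Pow.hom_inf y z w).ge

theorem below_top (U : Set X) : Below lift σ t U (⊤ : TObj V ar A) := fun y _ =>
  (Set.subset_univ _).trans (map_top y.hom).ge

theorem below_empty (z : TObj V ar A) : Below lift σ t ∅ z := fun _ _ => Set.empty_subset _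

theorem Below.unfoldTerm {U : Set X} {z : TObj V ar A} (hU : Below lift σ t U z) :
    Below lift σ t U (unfoldTerm (unfFix V ar) A z) := fun _ hy => hU _ hy.unfoldTerm_comp

theorem Below.modal {m : Λ} {U : Fin (ar m) → Set X} {z : Fin (ar m) → TObj V ar A}
    (h : ∀ i, Below lift σ t (U i) (z i)) :
    Below lift σ t (σ ⁻¹' (lift m).app X U) (TObj.modal m z) := fun _ hy =>
  (Set.preimage_mono ((lift m).monotone X fun i => h i _ hy.unfoldTerm_comp)).trans
    (ConcreteCategory.congr_hom hy.str₀ (opGen (modArity ar) m z)).ge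

theorem Below.sharp {s : Finset V} {γ : Scheme V ar s} {hg : γ.Guarded} {ha : γ.AllGuarded}
    (hγ : ∀ (p : s → unfObj (modArity ar) (fixArity V ar) A)
      (ξ : TObj V ar (unfObj (modArity ar) (fixArity V ar) A)) (P : s → Set X) (Ξ : Set X)
      (y : TObj V ar A ⟶ Pow.obj (op X)), IsSolution (modalAlg lift σ) t y (unfFix V ar) →
      (∀ v, P v ⊆ (stepDesc (modalAlg lift σ) t y (p v) : Set X)) →
      (∀ v, Below lift σ t (P v) (fold A (p v))) →
      Below lift σ t Ξ (FreeObj.bind (fold A) ξ) →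
      γ.sem lift σ P Ξ ⊆ (stepDesc (modalAlg lift σ) (stepDesc (modalAlg lift σ) t y)
        (FreeObj.bind (fold A) ≫ y) (γ.unfold hg ha p ξ) : Set X))
    {P : s → Set X} {z : s → TObj V ar A} (h : ∀ v, Below lift σ t (P v) (z v)) :
    Below lift σ t (lfpSet fun W => γ.sem lift σ P W) (TObj.sharp ⟨s, γ, hg, ha⟩ z) := by
  let W : Set X := ⋂₀ {U | ∃ (w : s → TObj V ar A) (y : TObj V ar A ⟶ Pow.obj (op X)),
    (∀ v, Below lift σ t (P v) (w v)) ∧ IsSolution (modalAlg lift σ) t y (unfFix V ar) ∧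
      U = y (TObj.sharp ⟨s, γ, hg, ha⟩ w)}
  have hle (w : s → TObj V ar A) (y : TObj V ar A ⟶ Pow.obj (op X))
      (hw : ∀ v, Below lift σ t (P v) (w v)) (hy : IsSolution (modalAlg lift σ) t y (unfFix V ar)) :
      W ⊆ (y (TObj.sharp ⟨s, γ, hg, ha⟩ w) : Set X) :=
    Set.sInter_subset_of_mem ⟨w, y, hw, hy, rfl⟩
  have hW : γ.sem lift σ P W ⊆ W := by
    refine Set.subset_sInter ?_
    rintro _ ⟨w, y, hw, hy, rfl⟩
    have e := ConcreteCategory.congr_hom hy.str₁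
      (opGen (fixArity V ar) (⟨s, γ, hg, ha⟩ : FixMod V ar) w)
    refine (hγ (fun v => unfStarApp (unfFix V ar) A (w v)) _ P W y hy
      (fun v => (hw v y hy).trans (ConcreteCategory.congr_hom hy (w v)).le)
      (fun v => (hw v).unfoldTerm) (fun y' hy' => ?_)).trans e.ge
    have e' : FreeObj.bind (fold A) (TObj.sharp ⟨s, γ, hg, ha⟩ fun v =>
        FreeObj.η (modArity ar) (fixArity V ar) _ (unfStarApp (unfFix V ar) A (w v))) =
        TObj.sharp ⟨s, γ, hg, ha⟩ fun v => CFL.unfoldTerm (unfFix V ar) A (w v) :=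
      FreeObj.bind_op _ (.inr (⟨s, γ, hg, ha⟩ : FixMod V ar)) _
    exact (hle _ y' (fun v => (hw v).unfoldTerm) hy').trans
      (congrArg (fun z => (y' z : Set X)) e').ge
  exact fun y hy => (Set.sInter_subset_of_mem hW).trans (hle z y h hy)

end

mutual
theorem Scheme.below_toT {s : Finset V} : (γ : Scheme V ar s) → (h : γ.AllGuarded) →
    (p : s → TObj V ar A) → (ξ : TObj V ar A) → (P : s → Set X) → (Ξ : Set X) →
    (∀ v, Below lift σ t (P v) (p v)) → Below lift σ t Ξ ξ →
      Below lift σ t (γ.sem lift σ P Ξ) (γ.toT h p ξ)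
  | .var v, _, _, _, _, _, hP, _ => hP v
  | .fix, _, _, _, _, _, _, hΞ => hΞ
  | .form φ, h, _, _, _, _, _, _ => φ.below_toT h
  | .or γ δ, h, p, ξ, P, Ξ, hP, hΞ =>
      (γ.below_toT h.1 p ξ P Ξ hP hΞ).sup (δ.below_toT h.2 p ξ P Ξ hP hΞ)
  | .and γ δ, h, p, ξ, P, Ξ, hP, hΞ =>
      (γ.below_toT h.1 p ξ P Ξ hP hΞ).inf (δ.below_toT h.2 p ξ P Ξ hP hΞ)
  | .modal _ γ, h, p, ξ, P, Ξ, hP, hΞ =>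
      Below.modal fun i => (γ i).below_toT (h i) p ξ P Ξ hP hΞ
  | .sharp γ δ, h, p, ξ, P, Ξ, hP, hΞ =>
      Below.sharp (γ.sem_subset_unfold h.1 h.2.1) fun i => (δ i).below_toT (h.2.2 i) p ξ P Ξ hP hΞ
theorem Formula.below_toT : (φ : Formula V ar) → (h : φ.AllGuarded) →
      Below lift σ t (φ.sem lift σ) (φ.toT h)
  | .top, _ => below_top _
  | .bot, _ => below_empty _
  | .or φ ψ, h => (φ.below_toT h.1).sup (ψ.below_toT h.2)
  | .and φ ψ, h => (φ.below_toT h.1).inf (ψ.below_toT h.2)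
  | .modal _ φ, h => Below.modal fun i => (φ i).below_toT (h i)
  | .sharp γ φ, h =>
      Below.sharp (γ.sem_subset_unfold h.1 h.2.1) fun i => (φ i).below_toT (h.2.2 i)
theorem Scheme.sem_subset_unfold {s : Finset V} : (γ : Scheme V ar s) → (hg : γ.Guarded) →
    (h : γ.AllGuarded) → (p : s → unfObj (modArity ar) (fixArity V ar) A) →
    (ξ : TObj V ar (unfObj (modArity ar) (fixArity V ar) A)) → (P : s → Set X) → (Ξ : Set X) →
    (y : TObj V ar A ⟶ Pow.obj (op X)) → IsSolution (modalAlg lift σ) t y (unfFix V ar) →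
    (∀ v, P v ⊆ (stepDesc (modalAlg lift σ) t y (p v) : Set X)) →
    (∀ v, Below lift σ t (P v) (fold A (p v))) →
    Below lift σ t Ξ (FreeObj.bind (fold A) ξ) →
      γ.sem lift σ P Ξ ⊆ (stepDesc (modalAlg lift σ) (stepDesc (modalAlg lift σ) t y)
        (FreeObj.bind (fold A) ≫ y) (γ.unfold hg h p ξ) : Set X)
  | .var v, _, _, p, _, _, _, _, _, hP, _, _ => (hP v).trans (stepDesc_inl lift σ _ _ (p v)).ge
  | .fix, hg, _, _, _, _, _, _, _, _, _, _ => hg.elim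
  | .form _, hg, _, _, _, _, _, _, _, _, _, _ => hg.elim
  | .or γ δ, hg, h, p, ξ, P, Ξ, y, hy, hP, hP', hΞ =>
      (Set.union_subset_union (γ.sem_subset_unfold hg.1 h.1 p ξ P Ξ y hy hP hP' hΞ)
        (δ.sem_subset_unfold hg.2 h.2 p ξ P Ξ y hy hP hP' hΞ)).trans
      (Pow.hom_sup (stepDesc (modalAlg lift σ) (stepDesc (modalAlg lift σ) t y)
        (FreeObj.bind (fold A) ≫ y)) _ _).ge
  | .and γ δ, hg, h, p, ξ, P, Ξ, y, hy, hP, hP', hΞ =>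
      (Set.inter_subset_inter (γ.sem_subset_unfold hg.1 h.1 p ξ P Ξ y hy hP hP' hΞ)
        (δ.sem_subset_unfold hg.2 h.2 p ξ P Ξ y hy hP hP' hΞ)).trans
      (Pow.hom_inf (stepDesc (modalAlg lift σ) (stepDesc (modalAlg lift σ) t y)
        (FreeObj.bind (fold A) ≫ y)) _ _).ge
  | .modal m γ, _, h, p, ξ, P, Ξ, y, hy, _, hP', hΞ =>
      (Set.preimage_mono ((lift m).monotone X fun i =>
        ((γ i).below_toT (h i) (fun v => fold A (p v)) (FreeObj.bind (fold A) ξ) P Ξ hP' hΞ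
          y hy).trans (congrArg (fun z => (y z : Set X)) ((γ i).bind_toT (fold A) (h i)
            (fun v => FreeObj.η (modArity ar) (fixArity V ar) _ (p v)) ξ)).ge)).trans
      (stepDesc_modal lift σ (stepDesc (modalAlg lift σ) t y) (FreeObj.bind (fold A) ≫ y) m
        fun i => (γ i).toT (h i)
          (fun v => FreeObj.η (modArity ar) (fixArity V ar) _ (p v)) ξ).ge
  | .sharp _ _, hg, _, _, _, _, _, _, _, _, _, _ => hg.elim
end

end Unfolding

section SemanticMap

variable {V Λ : Type} {ar : Λ → ℕ} {B : Type u ⥤ Type u}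
  (lift : (m : Λ) → PredLifting B (ar m)) {X : Type u} (σ : X ⟶ B.obj X)

variable (V) in
/-- The powerset of the state space as an algebra for the functor `T`. -/
noncomputable def powAlg : Endofunctor.Algebra (TFunctor.{u} V ar) where
  a := Pow.obj (op X)
  str := interp lift σ (𝟙 _)

variable {Φ : Endofunctor.Algebra (TFunctor.{u} V ar)} (hΦ : IsInitial Φ)

/-- The unique `T`-algebra morphism from the initial `T`-algebra to the powerset. -/
noncomputable def initInterp : Φ.a ⟶ Pow.obj (op X) := (hΦ.to (powAlg V lift σ)).f

theorem str_initInterp :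
    Φ.str ≫ initInterp lift σ hΦ = interp lift σ (initInterp lift σ hΦ) := by
  refine (hΦ.to (powAlg V lift σ)).h.symm.trans ?_
  exact FreeObj.map_lift (initInterp lift σ hΦ) (𝟙 _) _ _

theorem coprod_map_map_desc {A C D E : BddDistLat.{u}} (L : BddDistLat.{u} ⥤ BddDistLat.{u})
    (a : C ⟶ A) (t : A ⟶ D) (d : L.obj D ⟶ E) (p : E ⟶ D) :
    coprod.map (𝟙 A) (L.map a) ≫ coprod.map t (L.map t) ≫ coprod.map (𝟙 D) d ≫
      coprod.desc (𝟙 D) p = coprod.desc t (L.map (a ≫ t) ≫ d ≫ p) := by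
  simp

theorem str_step (t : Φ.a ⟶ Pow.obj (op X)) :
    Φ.str ≫ (cflSystem V lift).step hΦ σ t =
      unfStarApp (unfFix V ar) Φ.a ≫ stepDesc (modalAlg lift σ) t (Φ.str ≫ t) := by
  have hs : Φ.str ≫ Endofunctor.Algebra.Initial.strInv hΦ = 𝟙 _ :=
    Endofunctor.Algebra.Initial.right_inv hΦ
  refine (Category.assoc _ _ _).symm.trans ((congrArg (· ≫ _) hs).trans ?_)
  refine (Category.id_comp _).trans (congrArg (unfStarApp (unfFix V ar) Φ.a ≫ ·) ?_)
  exact coprod_map_map_desc (opFunctor (modArity ar)) Φ.str t ((oneStep lift).app (op X))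
    (Pow.map σ.op)

theorem eq_step_iff (t : Φ.a ⟶ Pow.obj (op X)) :
    t = (cflSystem V lift).step hΦ σ t ↔
      IsSolution (modalAlg lift σ) t (Φ.str ≫ t) (unfFix V ar) := by
  have : IsIso Φ.str := Endofunctor.Algebra.Initial.str_isIso hΦ
  have h := str_step lift σ hΦ t
  exact ⟨fun e => (congrArg (Φ.str ≫ ·) e).trans h,
    fun e => (cancel_epi Φ.str).1 (e.trans h.symm)⟩

theorem below_initPre (t : Φ.a ⟶ Pow.obj (op X))
    (ht : IsSolution (modalAlg lift σ) t (Φ.str ≫ t) (unfFix V ar))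
    (b : InitObj.{u} (modArity ar) (fixArity V ar)) :
    Below lift σ t (interp lift σ (initInterp lift σ hΦ)
      (initPre (modArity ar) (fixArity V ar) Φ.str b))
      (initPre (modArity ar) (fixArity V ar) Φ.str b) := by
  let s := initInterp lift σ hΦ
  let j := initPre (modArity ar) (fixArity V ar) Φ.str
  revert b
  refine Pres.ind fun b => ?_
  induction b with
  | gen g => exact g.elim
  | top => exact below_top _
  | bot =>
    have e : interp lift σ s (⊥ : TObj V ar Φ.a) = (∅ : Set X) := map_bot (interp lift σ s).hom
    exact (congrArg (fun U : Set X => Below lift σ t U (⊥ : TObj V ar Φ.a)) e).mpr (below_empty _)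
  | sup b c hb hc =>
    exact (congrArg (fun U : Set X => Below lift σ t U _)
      (Pow.hom_sup (interp lift σ s) (j (Pres.mk _ b)) (j (Pres.mk _ c)))).mpr (hb.sup hc)
  | inf b c hb hc =>
    exact (congrArg (fun U : Set X => Below lift σ t U _)
      (Pow.hom_inf (interp lift σ s) (j (Pres.mk _ b)) (j (Pres.mk _ c)))).mpr (hb.inf hc)
  | op o b hb =>
    rw [← Pres.op_mk]
    rcases o with _ | m | γ
    · have e := initPre_box (modArity ar) (fixArity V ar) Φ.str (Pres.mk _ (b ()))
      refine (congrArg (fun z => Below lift σ t (interp lift σ s z) z) e).mpr fun y hy => ?_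
      have h1 : interp lift σ s (j (Pres.mk _ (b ()))) ≤
        t (Φ.str (j (Pres.mk _ (b ())))) := hb () _ ht
      have h2 : s (Φ.str (j (Pres.mk _ (b ())))) = interp lift σ s (j (Pres.mk _ (b ()))) :=
        ConcreteCategory.congr_hom (str_initInterp lift σ hΦ) _
      have h3 : y (FreeObj.η (modArity ar) (fixArity V ar) Φ.a (Φ.str (j (Pres.mk _ (b ()))))) =
        t (Φ.str (j (Pres.mk _ (b ())))) := ConcreteCategory.congr_hom hy.η _
      exact h2.le.trans (h1.trans h3.ge)
    · have e := initPre_op (modArity ar) (fixArity V ar) Φ.str (.inl m)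
        fun i => Pres.mk _ (b i)
      refine (congrArg (fun z => Below lift σ t (interp lift σ s z) z) e).mpr ?_
      refine (congrArg (fun U : Set X => Below lift σ t U _)
        (interp_modal lift σ s m fun i => j (Pres.mk _ (b i)))).mpr ?_
      exact Below.modal hb
    · have e := initPre_op (modArity ar) (fixArity V ar) Φ.str (.inr γ)
        fun i => Pres.mk _ (b i)
      refine (congrArg (fun z => Below lift σ t (interp lift σ s z) z) e).mpr ?_
      refine (congrArg (fun U : Set X => Below lift σ t U _)
        (interp_sharp lift σ s γ fun i => j (Pres.mk _ (b i)))).mpr ?_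
      exact Below.sharp (γ.body.sem_subset_unfold lift σ t γ.guarded γ.allGuarded) hb

theorem isSemanticMap_initInterp :
    (cflSystem V lift).IsSemanticMap hΦ σ (initInterp lift σ hΦ) := by
  refine ⟨(eq_step_iff lift σ hΦ _).2 ?_, fun t ht a => ?_⟩
  · exact (congrArg (fun y => IsSolution (modalAlg lift σ) (initInterp lift σ hΦ) y (unfFix V ar))
      (str_initInterp lift σ hΦ)).mpr (isSolution_interp lift σ _)
  have ht' := (eq_step_iff lift σ hΦ t).1 ht
  let g := (initAlgIsInitial.{u} (modArity ar) (fixArity V ar)).to Φ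
  let g' := hΦ.to (initAlg.{u} (modArity ar) (fixArity V ar))
  have hg : g.f (g'.f a) = a :=
    ConcreteCategory.congr_hom (congrArg Endofunctor.Algebra.Hom.f (hΦ.hom_ext (g' ≫ g) (𝟙 Φ))) a
  have h := below_initPre lift σ hΦ t ht' (g'.f a) _ ht'
  have e : initInterp lift σ hΦ (Φ.str (initPre (modArity ar) (fixArity V ar) Φ.str (g'.f a))) =
      interp lift σ (initInterp lift σ hΦ) (initPre (modArity ar) (fixArity V ar) Φ.str (g'.f a)) :=
    ConcreteCategory.congr_hom (str_initInterp lift σ hΦ) _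
  have h' := e.le.trans h
  rw [← hg]
  exact h'

theorem initInterp_toAlg (φ : Formula V ar) (h : φ.AllGuarded) :
    initInterp lift σ hΦ (φ.toAlg Φ h) = φ.sem lift σ :=
  (ConcreteCategory.congr_hom (str_initInterp lift σ hΦ) (φ.toT h)).trans
    (φ.interp_toT lift σ _ h)

/-- The morphism from the initial bounded distributive lattice. -/
def zeroLat.desc (C : BddDistLat.{u}) : zeroLat.{u} ⟶ C :=
  Pres.lift _ PEmpty.elim (fun o => o.elim) (fun o => o.elim) (fun _ _ h => h.elim)

theorem flatten_interp :
    flatten hΦ ≫ interp lift σ (zeroLat.desc (Pow.obj (op X))) = initInterp lift σ hΦ := by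
  let k : formulaAlg V ar ⟶ powAlg V lift σ :=
    { f := interp lift σ (zeroLat.desc (Pow.obj (op X)))
      h := (FreeObj.map_lift _ (𝟙 _) _ _).trans (FreeObj.mul_lift _ _ _).symm }
  exact congrArg Endofunctor.Algebra.Hom.f
    (hΦ.hom_ext (hΦ.to (formulaAlg V ar) ≫ k) (hΦ.to (powAlg V lift σ)))

theorem initInterp_of_represents {a : Φ.a} {φ : Formula V ar} (h : Represents hΦ φ a) :
    initInterp lift σ hΦ a = φ.sem lift σ := by
  obtain ⟨hφ, e⟩ := h
  refine (ConcreteCategory.congr_hom (flatten_interp lift σ hΦ) a).symm.trans ?_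
  exact (congrArg (interp lift σ (zeroLat.desc (Pow.obj (op X)))) e).trans
    (φ.interp_toT lift σ _ hφ)

end SemanticMap

section Formulas

variable {V Λ : Type} {ar : Λ → ℕ}

theorem exists_formula_toT (x : TObj.{u} V ar zeroLat) :
    ∃ (φ : Formula V ar) (h : φ.AllGuarded), x = φ.toT h := by
  revert x
  refine Pres.ind fun x => ?_
  induction x with
  | gen g =>
    revert g
    refine Pres.ind fun g => ?_
    induction g with
    | gen g => exact g.elim
    | top => exact ⟨.top, trivial, map_top (FreeObj.η (modArity ar) (fixArity V ar) _).hom⟩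
    | bot => exact ⟨.bot, trivial, map_bot (FreeObj.η (modArity ar) (fixArity V ar) _).hom⟩
    | sup s t hs ht =>
      obtain ⟨φ, h, e⟩ := hs
      obtain ⟨ψ, k, e'⟩ := ht
      exact ⟨.or φ ψ, ⟨h, k⟩, (map_sup (FreeObj.η (modArity ar) (fixArity V ar) _).hom _ _).trans
        (congrArg₂ (· ⊔ ·) e e')⟩
    | inf s t hs ht =>
      obtain ⟨φ, h, e⟩ := hs
      obtain ⟨ψ, k, e'⟩ := ht
      exact ⟨.and φ ψ, ⟨h, k⟩, (map_inf (FreeObj.η (modArity ar) (fixArity V ar) _).hom _ _).trans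
        (congrArg₂ (· ⊓ ·) e e')⟩
    | op o => exact o.elim
  | top => exact ⟨.top, trivial, rfl⟩
  | bot => exact ⟨.bot, trivial, rfl⟩
  | sup s t hs ht =>
    obtain ⟨φ, h, e⟩ := hs
    obtain ⟨ψ, k, e'⟩ := ht
    exact ⟨.or φ ψ, ⟨h, k⟩, congrArg₂ (fun x y : TObj V ar zeroLat => x ⊔ y) e e'⟩
  | inf s t hs ht =>
    obtain ⟨φ, h, e⟩ := hs
    obtain ⟨ψ, k, e'⟩ := ht
    exact ⟨.and φ ψ, ⟨h, k⟩, congrArg₂ (fun x y : TObj V ar zeroLat => x ⊓ y) e e'⟩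
  | op o ts hts =>
    choose φ h e using hts
    rw [← Pres.op_mk]
    rcases o with m | γ
    · exact ⟨.modal m φ, h, congrArg (TObj.modal m) (funext e)⟩
    · exact ⟨.sharp γ.body φ, ⟨γ.guarded, γ.allGuarded, h⟩, congrArg (TObj.sharp γ) (funext e)⟩

end Formulas

end CFL

theorem mainTheorem4 {V Λ : Type} {ar : Λ → ℕ} {B : Type u ⥤ Type u}
    (lift : (m : Λ) → CFL.PredLifting B (ar m)) {X : Type u} (σ : X ⟶ B.obj X)
    (Φ : Endofunctor.Algebra (CFL.cflSystem V lift).L) (hΦ : IsInitial Φ) :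
    ∃ t : Φ.a ⟶ CFL.Pow.obj (op X),
      (CFL.cflSystem V lift).IsSemanticMap hΦ σ t ∧
      (∀ (φ : CFL.Formula V ar) (h : φ.AllGuarded),
        t (φ.toAlg Φ h) = φ.sem lift σ) ∧
      (∀ a : Φ.a, ∃ φ : CFL.Formula V ar, CFL.Represents hΦ φ a) ∧
      (∀ (a : Φ.a) (φ : CFL.Formula V ar), CFL.Represents hΦ φ a →
        t a = φ.sem lift σ) :=
  ⟨CFL.initInterp lift σ hΦ, CFL.isSemanticMap_initInterp lift σ hΦ,
    CFL.initInterp_toAlg lift σ hΦ,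
    fun a =>
      let ⟨φ, h, e⟩ := CFL.exists_formula_toT (CFL.flatten hΦ a)
      ⟨φ, h, e⟩,
    fun _ _ h => CFL.initInterp_of_represents lift σ hΦ h⟩
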